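/- Fix $0<\delta<1$ and let $R_\delta=\{z\in\mathbb C:\delta<|z|<1\}$. All Hilbert spaces are complex. Let $\mathcal F_{\mathrm{dp}}(\delta)$ be the class of bounded invertible Hilbert space operators $X$ with $\|X\|\le 1$, $\|X^{-1}\|\le 1/\delta$ and $\sigma(X)\subseteq R_\delta$. For $\varphi$ holomorphic on $R_\delta$ put $\|\varphi\|_{\mathrm{dp}}=\sup\{\|\varphi(X)\|: X\in\mathcal F_{\mathrm{dp}}(\delta)\}\in[0,\infty]$, where $\varphi(X)$ is given by the Riesz–Dunford functional calculus. Let $\lambda_1,\dots,\lambda_n\in R_\delta$ be distinct and let $z_1,\dots,z_n\in\mathbb C$. The DP Pick problem $\lambda_j\mapsto z_j$ $(j=1,\dots,n)$ is called solvable if there is a holomorphic $\varphi$ on $R_\delta$ with $\|\varphi\|_{\mathrm{dp}}\le 1$ and $\varphi(\lambda_j)=z_j$ for all $j$. It is called extremally solvable if it is solvable and there is no such $\varphi$ with $\|\varphi\|_{\mathrm{dp}}<1$. **Theorem.** If the DP Pick problem $\lambda_j\mapsto z_j$ $(j=1,\dots,n)$ is extremally solvable, then there is a rational function $\varphi$,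 without poles in $R_\delta$, with $\|\varphi\|_{\mathrm{dp}}\le 1$ and $\varphi(\lambda_j)=z_j$ for $j=1,\dots,n$, which has a finite-dimensional model: there are a Hilbert space $\mathcal M=\mathcal M_1\oplus\mathcal M_2$ (orthogonal direct sum) with $\dim\mathcal M\le 2n$ and a holomorphic function $u:R_\delta\to\mathcal M$ such that $$1-\overline{\varphi(\mu)}\varphi(\lambda)=\big\langle (1-E(\mu)^*E(\lambda))\,u(\lambda),u(\mu)\big\rangle_{\mathcal M}\qquad(\lambda,\mu\in R_\delta),$$ where $E(\lambda)=\begin{bmatrix}\lambda&0\\0&\delta/\lambda\end{bmatrix}$ with respect to $\mathcal M=\mathcal M_1\oplus\mathcal M_2$. Furthermore, there is an operator $T\in\mathcal F_{\mathrm{dp}}(\delta)$ acting on an $n$-dimensional Hilbert space $\mathcal H$, with $\sigma(T)=\{\lambda_1,\dots,\lambda_n\}$, such that $$\|\varphi\|_{\mathrm{dp}}=\|\varphi(T)\|=1\qquad\text{and}\qquad 1-\varphi(T)^*\varphi(T)=u(T)^*\big(1-E(T)^*E(T)\big)u(T).$$ Here $u(T):\mathcal H\to\mathcal M\otimes\mathcal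 H$ and $E(T):\mathcal M\otimes\mathcal H\to\mathcal M\otimes\mathcal H$ are given by the Riesz–Dunford calculus, $F(T)=\frac1{2\pi i}\int_\Gamma F(z)\otimes(z-T)^{-1}\,dz$, with $\Gamma$ a positively oriented contour in $R_\delta$ surrounding $\sigma(T)$. -/

import Mathlib

open scoped TensorProduct ENNReal ComplexConjugate InnerProduct

noncomputable section

namespace DP

/-- The open annulus `R_δ = {z : δ < |z| < 1}`. -/
def annulus (δ : ℝ) : Set ℂ := {z | δ < ‖z‖ ∧ ‖z‖ < 1}

/-! ### The Riesz-Dunford functional calculus on the annulus -/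

section Calculus

variable {H : Type*} [NormedAddCommGroup H] [InnerProductSpace ℂ H]

/-- `r < R` are admissible radii for `T`: the circles `|z| = r` and `|z| = R` lie in `R_δ`, and the
spectrum of `T` lies strictly between them. -/
def IsSeparating (δ : ℝ) (T : H →L[ℂ] H) (p : ℝ × ℝ) : Prop :=
  δ < p.1 ∧ p.1 < p.2 ∧ p.2 < 1 ∧ ∀ z ∈ spectrum ℂ T, p.1 < ‖z‖ ∧ ‖z‖ < p.2

/-- `(2πi)⁻¹` times the integral of `G` over the boundary of `{r < |z| < R}`, positively
oriented. -/
def boundaryIntegral {V : Type*} [NormedAddCommGroup V] [NormedSpace ℂ V] (r R : ℝ) (G : ℂ → V) :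
    V :=
  (2 * Real.pi * Complex.I : ℂ)⁻¹ • ((∮ z in C(0, R), G z) - ∮ z in C(0, r), G z)

/-- `(2πi)⁻¹` times the integral of `G` over a contour in `R_δ` that surrounds `σ(T)`. When
`σ(T) ⊆ R_δ` a contour exists (`exists_isSeparating`), and when moreover `G` is holomorphic on
`R_δ \ σ(T)` the value does not depend on the contour (`contourIntegral_eq`). -/
def contourIntegral {V : Type*} [NormedAddCommGroup V] [NormedSpace ℂ V] (δ : ℝ)
    (T : H →L[ℂ] H) (G : ℂ → V) : V :=
  boundaryIntegral (Classical.epsilon (IsSeparating δ T)).1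
    (Classical.epsilon (IsSeparating δ T)).2 G

theorem exists_isSeparating [CompleteSpace H] {δ : ℝ} (hδ : δ < 1) {T : H →L[ℂ] H}
    (hT : spectrum ℂ T ⊆ annulus δ) : ∃ p, IsSeparating δ T p := by
  rcases (spectrum ℂ T).eq_empty_or_nonempty with h | h
  · obtain ⟨a, h1, h2⟩ := exists_between hδ
    obtain ⟨b, h3, h4⟩ := exists_between h2
    exact ⟨(a, b), h1, h3, h4, by simp [h]⟩
  · have hc := spectrum.isCompact (𝕜 := ℂ) T
    obtain ⟨x, hx, hx'⟩ := hc.exists_isMinOn h continuous_norm.continuousOn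
    obtain ⟨y, hy, hy'⟩ := hc.exists_isMaxOn h continuous_norm.continuousOn
    obtain ⟨a, h1, h2⟩ := exists_between (hT hx).1
    obtain ⟨b, h3, h4⟩ := exists_between (hT hy).2
    have hxy : ‖x‖ ≤ ‖y‖ := hx' hy
    exact ⟨(a, b), h1, by dsimp only; linarith, h4,
      fun z hz => ⟨h2.trans_le (hx' hz), (hy' hz : ‖z‖ ≤ ‖y‖).trans_lt h3⟩⟩

theorem circleIntegral_eq_of_separating {V : Type*} [NormedAddCommGroup V] [NormedSpace ℂ V] [CompleteSpace V]
    {T : H →L[ℂ] H} {δ : ℝ} (hδ : 0 ≤ δ) {G : ℂ → V}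
    (hG : DifferentiableOn ℂ G (annulus δ \ spectrum ℂ T)) (ho : IsOpen (annulus δ \ spectrum ℂ T))
    {a b : ℝ} (ha : δ < a) (hab : a ≤ b) (hb : b < 1)
    (h : ∀ z ∈ spectrum ℂ T, ‖z‖ < a ∨ b < ‖z‖) :
    (∮ z in C(0, b), G z) = ∮ z in C(0, a), G z := by
  have key : ∀ z : ℂ, a ≤ ‖z‖ → ‖z‖ ≤ b → DifferentiableAt ℂ G z := fun z h1 h2 => by
    have hz : z ∈ annulus δ \ spectrum ℂ T :=
      ⟨⟨ha.trans_le h1, h2.trans_lt hb⟩, fun hs => by rcases h z hs with h | h <;> linarith⟩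
    exact (hG z hz).differentiableAt (ho.mem_nhds hz)
  refine Complex.circleIntegral_eq_of_differentiable_on_annulus_off_countable
    (hδ.trans_lt ha) hab Set.countable_empty (fun z hz => ?_) fun z hz => ?_
  · simp only [Set.mem_sdiff, Metric.mem_closedBall, Metric.mem_ball, dist_zero_right,
      not_lt] at hz
    exact (key z hz.2 hz.1).continuousAt.continuousWithinAt
  · simp only [Set.sdiff_empty, Set.mem_sdiff, Metric.mem_closedBall, Metric.mem_ball,
      dist_zero_right, not_le] at hz
    exact key z hz.2.le hz.1.le

theorem contourIntegral_eq [CompleteSpace H] {V : Type*} [NormedAddCommGroup V] [NormedSpace ℂ V]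
    [CompleteSpace V] {δ : ℝ} (hδ : 0 ≤ δ) {T : H →L[ℂ] H} {G : ℂ → V}
    (hG : DifferentiableOn ℂ G (annulus δ \ spectrum ℂ T)) {p : ℝ × ℝ}
    (hp : IsSeparating δ T p) : contourIntegral δ T G = boundaryIntegral p.1 p.2 G := by
  have ho : IsOpen (annulus δ \ spectrum ℂ T) :=
    ((isOpen_lt continuous_const continuous_norm).inter
      (isOpen_lt continuous_norm continuous_const)).sdiff (spectrum.isClosed (𝕜 := ℂ) T)
  obtain ⟨q, hq, hq'⟩ : ∃ q, IsSeparating δ T q ∧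
      contourIntegral δ T G = boundaryIntegral q.1 q.2 G :=
    ⟨_, Classical.epsilon_spec ⟨p, hp⟩, rfl⟩
  obtain ⟨p1, p2, p3, p4⟩ := hp
  obtain ⟨q1, q2, q3, q4⟩ := hq
  rw [hq', boundaryIntegral, boundaryIntegral]
  congr 2
  · rcases le_total q.2 p.2 with h | h
    · exact (circleIntegral_eq_of_separating hδ hG ho (q1.trans q2) h p3 fun z hz => .inl (q4 z hz).2).symm
    · exact circleIntegral_eq_of_separating hδ hG ho (p1.trans p2) h q3 fun z hz => .inl (p4 z hz).2
  · rcases le_total q.1 p.1 with h | h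
    · exact (circleIntegral_eq_of_separating hδ hG ho q1 h (p2.trans p3) fun z hz => .inr (p4 z hz).1).symm
    · exact circleIntegral_eq_of_separating hδ hG ho p1 h (q2.trans q3) fun z hz => .inr (q4 z hz).1

/-- `φ(T) = (2πi)⁻¹ ∮ φ(z) (z - T)⁻¹ dz` for a scalar function `φ`. -/
def scalarCalc (δ : ℝ) (φ : ℂ → ℂ) (T : H →L[ℂ] H) : H →L[ℂ] H :=
  contourIntegral δ T fun z => φ z • resolvent T z

/-- `u(T) = (2πi)⁻¹ ∮ u(z) ⊗ (z - T)⁻¹ dz`, an operator from `H` to `M ⊗ H`, for a function `u`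
with values in `M`. -/
def vectorCalc {M : Type*} [NormedAddCommGroup M] [InnerProductSpace ℂ M]
    [FiniteDimensional ℂ M] [FiniteDimensional ℂ H]
    (δ : ℝ) (u : ℂ → M) (T : H →L[ℂ] H) : H →L[ℂ] M ⊗[ℂ] H :=
  contourIntegral δ T fun z => TensorProduct.mkL ℂ M H (u z) ∘L resolvent T z

/-- `F(T) = (2πi)⁻¹ ∮ F(z) ⊗ (z - T)⁻¹ dz`, an operator on `M ⊗ H`, for a function `F` with
values in the operators on `M`. -/
def operatorCalc {M : Type*} [NormedAddCommGroup M] [InnerProductSpace ℂ M]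
    [FiniteDimensional ℂ M] [FiniteDimensional ℂ H]
    (δ : ℝ) (F : ℂ → M →L[ℂ] M) (T : H →L[ℂ] H) : M ⊗[ℂ] H →L[ℂ] M ⊗[ℂ] H :=
  contourIntegral δ T fun z => TensorProduct.mapL (F z) (resolvent T z)

instance instCompleteSpaceTensor {M : Type*} [NormedAddCommGroup M] [InnerProductSpace ℂ M]
    [FiniteDimensional ℂ M] [FiniteDimensional ℂ H] : CompleteSpace (M ⊗[ℂ] H) :=
  FiniteDimensional.complete ℂ _

/-! ### The Douglas-Paulsen family and norm -/

/-- `X` is a Douglas-Paulsen operator with parameter `δ`: `‖X‖ ≤ 1` and `‖X⁻¹‖ ≤ 1/δ`. -/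
def IsDouglasPaulsen (δ : ℝ) (X : H →L[ℂ] H) : Prop :=
  ‖X‖ ≤ 1 ∧ IsUnit X ∧ ‖Ring.inverse X‖ ≤ 1 / δ

/-- The Douglas-Paulsen family `F_dp(δ)`. -/
def DPFamily (δ : ℝ) (X : H →L[ℂ] H) : Prop :=
  IsDouglasPaulsen δ X ∧ spectrum ℂ X ⊆ annulus δ

/-- The family `F_dp(δ, λ)`: members of `F_dp(δ)` that act on an `n`-dimensional space and have
spectrum `{λ_1, …, λ_n}`. -/
def DPFamilyAt {n : ℕ} (δ : ℝ) (lam : Fin n → ℂ) (T : H →L[ℂ] H) : Prop :=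
  DPFamily δ T ∧ FiniteDimensional ℂ H ∧ Module.finrank ℂ H = n ∧ spectrum ℂ T = Set.range lam

end Calculus

/-- The Douglas-Paulsen norm: the supremum, possibly `∞`, of `‖φ(X)‖` over all `X` in `F_dp(δ)` on
any complex Hilbert space. -/
def dpNorm (δ : ℝ) (φ : ℂ → ℂ) : ℝ≥0∞ :=
  sSup {c | ∃ (H : Type) (_ : NormedAddCommGroup H) (_ : InnerProductSpace ℂ H)
    (_ : CompleteSpace H) (X : H →L[ℂ] H), DPFamily δ X ∧ c = ‖scalarCalc δ φ X‖ₑ}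

/-- The dp-Schur class. -/
def DPSchur (δ : ℝ) (φ : ℂ → ℂ) : Prop :=
  DifferentiableOn ℂ φ (annulus δ) ∧ dpNorm δ φ ≤ 1

/-- The DP Pick problem `λ_j ↦ z_j` is solvable. -/
def Solvable {n : ℕ} (δ : ℝ) (lam z : Fin n → ℂ) : Prop :=
  ∃ φ, DPSchur δ φ ∧ ∀ j, φ (lam j) = z j

/-- The DP Pick problem `λ_j ↦ z_j` is extremally solvable. -/
def ExtremallySolvable {n : ℕ} (δ : ℝ) (lam z : Fin n → ℂ) : Prop :=
  Solvable δ lam z ∧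
    ¬ ∃ φ : ℂ → ℂ, DifferentiableOn ℂ φ (annulus δ) ∧ dpNorm δ φ < 1 ∧ ∀ j, φ (lam j) = z j

/-- `φ` agrees on the set `S` with a rational function without poles in `S`. -/
def IsRationalOn (S : Set ℂ) (φ : ℂ → ℂ) : Prop :=
  ∃ p q : Polynomial ℂ, ∀ z ∈ S, q.eval z ≠ 0 ∧ φ z = p.eval z / q.eval z

section Model

variable {M₁ M₂ : Type*} [NormedAddCommGroup M₁] [InnerProductSpace ℂ M₁]
  [NormedAddCommGroup M₂] [InnerProductSpace ℂ M₂]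

variable (M₁ M₂) in
/-- The operator `E(z) = diag(z, δ/z)` on the Hilbert space direct sum `M₁ ⊕ M₂`. -/
def pencil (δ : ℝ) (z : ℂ) : WithLp 2 (M₁ × M₂) →L[ℂ] WithLp 2 (M₁ × M₂) :=
  (WithLp.prodContinuousLinearEquiv 2 ℂ M₁ M₂).symm.toContinuousLinearMap ∘L
    ((z • ContinuousLinearMap.id ℂ M₁).prodMap ((δ / z) • ContinuousLinearMap.id ℂ M₂)) ∘L
    (WithLp.prodContinuousLinearEquiv 2 ℂ M₁ M₂).toContinuousLinearMap

/-- `(M₁ ⊕ M₂, u)` with `u` holomorphic is a dp-model of `φ`: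
`1 - conj(φ(μ)) φ(λ) = ⟨(1 - E(μ)* E(λ)) u(λ), u(μ)⟩` on `R_δ`. Mathlib's inner product is
conjugate linear in the first variable. -/
def IsDPModel [CompleteSpace M₁] [CompleteSpace M₂] (δ : ℝ) (φ : ℂ → ℂ)
    (u : ℂ → WithLp 2 (M₁ × M₂)) : Prop :=
  DifferentiableOn ℂ u (annulus δ) ∧
    ∀ l ∈ annulus δ, ∀ m ∈ annulus δ,
      1 - conj (φ m) * φ l =
        inner ℂ (u m) ((1 - (pencil M₁ M₂ δ m)† ∘L pencil M₁ M₂ δ l) (u l))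

end Model

end DP

end

namespace DP

/-! ### Properties of the Riesz-Dunford calculus -/

/-! Everything reduces to matrices. Let T be a Douglas-Paulsen operator on ℂⁿ with characteristic
polynomial ∏ (X - λ_j). The λ_j are distinct, so T has an eigenbasis and φ(T) depends only on the
values φ(λ_j); it equals p(T) for any interpolating polynomial p. These T form a nonempty compact
set of test operators.

The core is a duality (`one_sub_mem_gramCone`): if ‖p(T)‖ ≤ 1 on all test operators, then 1 -
conj(z_i) z_j is a sum of two positive matrices, weighted entrywise by 1 - conj(λ_i) λ_j and by 1 -
conj(δ/λ_i)(δ/λ_j). Otherwise Hahn-Banach yields a Hermitian form Q, positive on the closed cone of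
such sums and negative on the Pick matrix. Positivity says that multiplication by λ_j and by δ/λ_j
contracts Q. Hence Q, after a small definite perturbation, is the norm of a space on which
multiplication by λ_j is a test operator; contractivity of p there contradicts negativity on the
Pick matrix.

The weighted sum is a Gram identity, so a lurking isometry gives a unitary W on ℂ ⊕ ℂⁿ ⊕ ℂⁿ. Solving
(φ, u) = W(1, E u) gives a rational φ that interpolates the data (`exists_realization_of_gram`).
Since W is isometric, this one equation yields the model formula, and, through the functional
calculus, its operator version and ‖φ(X)‖ ≤ 1 on the whole family.

Extremality enters once (`ExtremallySolvable.exists_norm_aeval_eq_one`). By compactness ‖p(T)‖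
attains its maximum. A maximum below 1 would let p be divided by some ρ < 1, and the realization for
p/ρ, scaled back, would solve the problem with norm at most ρ. So the maximum is 1, attained at the
required T. -/

theorem isOpen_annulus (δ : ℝ) : IsOpen (annulus δ) :=
  (isOpen_lt continuous_const continuous_norm).inter (isOpen_lt continuous_norm continuous_const)

theorem ne_zero_of_mem_annulus {δ : ℝ} (hδ : 0 ≤ δ) {z : ℂ} (hz : z ∈ annulus δ) : z ≠ 0 :=
  norm_pos_iff.mp (hδ.trans_lt hz.1)

section Calculus

variable {V W : Type*} [NormedAddCommGroup V] [NormedSpace ℂ V] [NormedAddCommGroup W]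
  [NormedSpace ℂ W]

theorem circleIntegral_clm [CompleteSpace V] [CompleteSpace W] (L : V →L[ℂ] W) {G : ℂ → V}
    {c : ℂ} {R : ℝ} (hG : CircleIntegrable G c R) :
    (∮ z in C(c, R), L (G z)) = L (∮ z in C(c, R), G z) := by
  simp only [circleIntegral]
  rw [← ContinuousLinearMap.intervalIntegral_comp_comm _ hG.out]
  simp

variable {H : Type*} [NormedAddCommGroup H] [InnerProductSpace ℂ H] [CompleteSpace H]
  {δ : ℝ} {X : H →L[ℂ] H}

/-- `(r, R)` are the radii used by `contourIntegral`. -/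
theorem exists_epsilon_eq (hδ : δ < 1) (hX : spectrum ℂ X ⊆ annulus δ) :
    ∃ r R, δ < r ∧ r < R ∧ R < 1 ∧ (∀ z ∈ spectrum ℂ X, r < ‖z‖ ∧ ‖z‖ < R) ∧
      Classical.epsilon (IsSeparating δ X) = (r, R) := by
  obtain ⟨h1, h2, h3, h4⟩ := Classical.epsilon_spec (exists_isSeparating hδ hX)
  exact ⟨_, _, h1, h2, h3, h4, rfl⟩

variable (hδ0 : 0 < δ) (hδ : δ < 1) (hX : spectrum ℂ X ⊆ annulus δ)
include hδ0 hδ hX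

theorem contourIntegral_congr {G G' : ℂ → V}
    (h : Set.EqOn G G' (annulus δ \ spectrum ℂ X)) :
    contourIntegral δ X G = contourIntegral δ X G' := by
  obtain ⟨r, R, h1, h2, h3, h4, h5⟩ := exists_epsilon_eq hδ hX
  simp only [contourIntegral, h5, boundaryIntegral]
  congr 2
  · refine circleIntegral.integral_congr (by linarith) fun z hz => h ?_
    rw [mem_sphere_zero_iff_norm] at hz
    exact ⟨⟨by linarith, by linarith⟩, fun hs => by linarith [(h4 z hs).2]⟩
  · refine circleIntegral.integral_congr (by linarith) fun z hz => h ?_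
    rw [mem_sphere_zero_iff_norm] at hz
    exact ⟨⟨by linarith, by linarith⟩, fun hs => by linarith [(h4 z hs).1]⟩

theorem contourIntegral_clm [CompleteSpace V] [CompleteSpace W] (L : V →L[ℂ] W) {G : ℂ → V}
    (hG : ContinuousOn G (annulus δ \ spectrum ℂ X)) :
    contourIntegral δ X (fun z => L (G z)) = L (contourIntegral δ X G) := by
  obtain ⟨r, R, h1, h2, h3, h4, h5⟩ := exists_epsilon_eq hδ hX
  simp only [contourIntegral, h5, boundaryIntegral]
  rw [circleIntegral_clm, circleIntegral_clm]
  · simp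
  · refine ContinuousOn.circleIntegrable (by linarith) (hG.mono fun z hz => ?_)
    rw [mem_sphere_zero_iff_norm] at hz
    exact ⟨⟨by linarith, by linarith⟩, fun hs => by linarith [(h4 z hs).1]⟩
  · refine ContinuousOn.circleIntegrable (by linarith) (hG.mono fun z hz => ?_)
    rw [mem_sphere_zero_iff_norm] at hz
    exact ⟨⟨by linarith, by linarith⟩, fun hs => by linarith [(h4 z hs).2]⟩

theorem contourIntegral_add {G G' : ℂ → V}
    (hG : ContinuousOn G (annulus δ \ spectrum ℂ X))
    (hG' : ContinuousOn G' (annulus δ \ spectrum ℂ X)) :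
    contourIntegral δ X (fun z => G z + G' z) =
      contourIntegral δ X G + contourIntegral δ X G' := by
  obtain ⟨r, R, h1, h2, h3, h4, h5⟩ := exists_epsilon_eq hδ hX
  have hR : Metric.sphere (0 : ℂ) R ⊆ annulus δ \ spectrum ℂ X := fun z hz => by
    rw [mem_sphere_zero_iff_norm] at hz
    exact ⟨⟨by linarith, by linarith⟩, fun hs => by linarith [(h4 z hs).2]⟩
  have hr : Metric.sphere (0 : ℂ) r ⊆ annulus δ \ spectrum ℂ X := fun z hz => by
    rw [mem_sphere_zero_iff_norm] at hz
    exact ⟨⟨by linarith, by linarith⟩, fun hs => by linarith [(h4 z hs).1]⟩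
  simp only [contourIntegral, h5, boundaryIntegral]
  rw [circleIntegral.integral_add, circleIntegral.integral_add, ← smul_add]
  · congr 1; abel
  · exact ContinuousOn.circleIntegrable (by linarith) (hG.mono hr)
  · exact ContinuousOn.circleIntegrable (by linarith) (hG'.mono hr)
  · exact ContinuousOn.circleIntegrable (by linarith) (hG.mono hR)
  · exact ContinuousOn.circleIntegrable (by linarith) (hG'.mono hR)

theorem contourIntegral_sum {ι : Type*} (s : Finset ι) {G : ι → ℂ → V}
    (hG : ∀ i ∈ s, ContinuousOn (G i) (annulus δ \ spectrum ℂ X)) :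
    contourIntegral δ X (fun z => ∑ i ∈ s, G i z) = ∑ i ∈ s, contourIntegral δ X (G i) := by
  classical
  induction s using Finset.induction_on with
  | empty =>
    simp [contourIntegral, boundaryIntegral, circleIntegral]
  | insert i s hi ih =>
    simp only [Finset.sum_insert hi]
    rw [contourIntegral_add hδ0 hδ hX (hG i (by simp))
      (continuousOn_finsetSum s fun j hj => hG j (by simp [hj])),
      ih fun j hj => hG j (by simp [hj])]

/-- Cauchy's theorem. -/
theorem contourIntegral_eq_zero [CompleteSpace V] {G : ℂ → V}
    (hG : DifferentiableOn ℂ G (annulus δ)) : contourIntegral δ X G = 0 := by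
  obtain ⟨r, R, h1, h2, h3, h4, h5⟩ := exists_epsilon_eq hδ hX
  have hG' : ∀ z ∈ annulus δ, DifferentiableAt ℂ G z := fun z hz =>
    (hG z hz).differentiableAt ((isOpen_annulus δ).mem_nhds hz)
  simp only [contourIntegral, h5, boundaryIntegral]
  rw [sub_eq_zero.mpr, smul_zero]
  refine Complex.circleIntegral_eq_of_differentiable_on_annulus_off_countable
    (hδ0.trans h1) h2.le Set.countable_empty (fun z hz => ?_) fun z hz => ?_
  · simp only [Set.mem_sdiff, Metric.mem_closedBall, Metric.mem_ball, dist_zero_right,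
      not_lt] at hz
    exact (hG' z ⟨by linarith, by linarith⟩).continuousAt.continuousWithinAt
  · simp only [Set.sdiff_empty, Set.mem_sdiff, Metric.mem_closedBall, Metric.mem_ball,
      dist_zero_right, not_le] at hz
    exact hG' z ⟨by linarith, by linarith⟩

omit hδ0 hδ hX in
theorem differentiableAt_resolvent {z : ℂ} (hz : z ∉ spectrum ℂ X) :
    DifferentiableAt ℂ (resolvent X) z :=
  (spectrum.hasDerivAt_resolvent_const_left
    (by rwa [spectrum, Set.notMem_compl_iff] at hz)).differentiableAt

omit hδ0 hδ hX in
theorem continuousOn_smul_resolvent {φ : ℂ → ℂ} (hφ : DifferentiableOn ℂ φ (annulus δ)) :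
    ContinuousOn (fun z => φ z • resolvent X z) (annulus δ \ spectrum ℂ X) :=
  (hφ.continuousOn.mono Set.sdiff_subset).smul
    fun _ hz => (differentiableAt_resolvent hz.2).continuousAt.continuousWithinAt

omit hδ0 hδ hX [CompleteSpace H] in
theorem resolvent_mul_sub {z : ℂ} (hz : z ∉ spectrum ℂ X) :
    resolvent X z * (algebraMap ℂ _ z - X) = 1 :=
  Ring.inverse_mul_cancel _ (by rwa [spectrum.notMem_iff] at hz)

omit hδ0 hδ hX [CompleteSpace H] in
theorem sub_mul_resolvent {z : ℂ} (hz : z ∉ spectrum ℂ X) :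
    (algebraMap ℂ _ z - X) * resolvent X z = 1 :=
  Ring.mul_inverse_cancel _ (by rwa [spectrum.notMem_iff] at hz)

omit hδ0 hδ hX [CompleteSpace H] in
theorem smul_resolvent_eq {z : ℂ} (hz : z ∉ spectrum ℂ X) :
    z • resolvent X z = 1 + resolvent X z * X := by
  rw [← resolvent_mul_sub hz, mul_sub, Algebra.algebraMap_eq_smul_one, mul_smul_comm, mul_one]
  abel

omit hδ0 hδ hX [CompleteSpace H] in
theorem smul_resolvent_eq' {z : ℂ} (hz : z ∉ spectrum ℂ X) :
    z • resolvent X z = 1 + X * resolvent X z := by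
  rw [← sub_mul_resolvent hz, sub_mul, Algebra.algebraMap_eq_smul_one, smul_mul_assoc, one_mul]
  abel

theorem scalarCalc_congr {φ ψ : ℂ → ℂ} (h : Set.EqOn φ ψ (annulus δ)) :
    scalarCalc δ φ X = scalarCalc δ ψ X :=
  contourIntegral_congr hδ0 hδ hX fun z hz => by simp only [h hz.1]

theorem scalarCalc_add {φ ψ : ℂ → ℂ} (hφ : DifferentiableOn ℂ φ (annulus δ))
    (hψ : DifferentiableOn ℂ ψ (annulus δ)) :
    scalarCalc δ (fun z => φ z + ψ z) X = scalarCalc δ φ X + scalarCalc δ ψ X := by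
  rw [scalarCalc, scalarCalc, scalarCalc, ← contourIntegral_add hδ0 hδ hX
    (continuousOn_smul_resolvent hφ) (continuousOn_smul_resolvent hψ)]
  simp only [add_smul]

theorem scalarCalc_sum {ι : Type*} (s : Finset ι) {φ : ι → ℂ → ℂ}
    (hφ : ∀ i ∈ s, DifferentiableOn ℂ (φ i) (annulus δ)) :
    scalarCalc δ (fun z => ∑ i ∈ s, φ i z) X = ∑ i ∈ s, scalarCalc δ (φ i) X := by
  simp only [scalarCalc, Finset.sum_smul]
  exact contourIntegral_sum hδ0 hδ hX s fun i hi => continuousOn_smul_resolvent (hφ i hi)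

omit hδ0 hδ hX [CompleteSpace H] in
theorem scalarCalc_const_mul (c : ℂ) (φ : ℂ → ℂ) :
    scalarCalc δ (fun z => c * φ z) X = c • scalarCalc δ φ X := by
  simp only [scalarCalc, contourIntegral, boundaryIntegral, mul_smul]
  rw [circleIntegral.integral_smul, circleIntegral.integral_smul, ← smul_sub, smul_comm]

/-- Since z(z - X)⁻¹ = 1 + (z - X)⁻¹X, the two sides differ by the integral of the holomorphic
function φ · 1, which vanishes by Cauchy's theorem. -/
theorem scalarCalc_mul_id {φ : ℂ → ℂ} (hφ : DifferentiableOn ℂ φ (annulus δ)) :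
    scalarCalc δ (fun z => φ z * z) X = scalarCalc δ φ X * X := by
  have h1 := contourIntegral_clm hδ0 hδ hX ((ContinuousLinearMap.mul ℂ (H →L[ℂ] H)).flip X)
    (continuousOn_smul_resolvent (X := X) hφ)
  have hd : DifferentiableOn ℂ (fun z => φ z • (1 : H →L[ℂ] H)) (annulus δ) :=
    hφ.smul_const _
  have h2 := contourIntegral_eq_zero hδ0 hδ hX hd
  simp only [ContinuousLinearMap.flip_apply, ContinuousLinearMap.mul_apply'] at h1
  change _ = contourIntegral δ X _ * X
  refine Eq.trans ?_ ((contourIntegral_add hδ0 hδ hX (G := fun z => φ z • (1 : H →L[ℂ] H))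
    (G' := fun z => φ z • resolvent X z * X) ?_ ?_).trans
    (by rw [h1, h2, zero_add]))
  · refine contourIntegral_congr hδ0 hδ hX fun z hz => ?_
    simp only [mul_smul, smul_resolvent_eq hz.2, smul_add, smul_mul_assoc]
  · exact hd.continuousOn.mono Set.sdiff_subset
  · exact (continuousOn_smul_resolvent hφ).mul continuousOn_const

theorem scalarCalc_id_mul {φ : ℂ → ℂ} (hφ : DifferentiableOn ℂ φ (annulus δ)) :
    scalarCalc δ (fun z => z * φ z) X = X * scalarCalc δ φ X := by
  have h1 := contourIntegral_clm hδ0 hδ hX (ContinuousLinearMap.mul ℂ (H →L[ℂ] H) X)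
    (continuousOn_smul_resolvent (X := X) hφ)
  have hd : DifferentiableOn ℂ (fun z => φ z • (1 : H →L[ℂ] H)) (annulus δ) :=
    hφ.smul_const _
  have h2 := contourIntegral_eq_zero hδ0 hδ hX hd
  simp only [ContinuousLinearMap.mul_apply'] at h1
  change _ = X * contourIntegral δ X _
  refine Eq.trans ?_ ((contourIntegral_add hδ0 hδ hX (G := fun z => φ z • (1 : H →L[ℂ] H))
    (G' := fun z => X * φ z • resolvent X z) ?_ ?_).trans
    (by rw [h1, h2, zero_add]))
  · refine contourIntegral_congr hδ0 hδ hX fun z hz => ?_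
    simp only [mul_comm z, mul_smul, smul_resolvent_eq' hz.2, smul_add, mul_smul_comm]
  · exact hd.continuousOn.mono Set.sdiff_subset
  · exact continuousOn_const.mul (continuousOn_smul_resolvent hφ)

/-- The inner circle contributes nothing, the resolvent being holomorphic on its disc. The outer
circle can be pushed to infinity, where (z - X)⁻¹ differs from 1/z by z⁻¹X(z - X)⁻¹ = o(1/|z|). -/
theorem scalarCalc_one : scalarCalc δ (fun _ => 1) X = 1 := by
  obtain ⟨r, R, h1, h2, h3, h4, h5⟩ := exists_epsilon_eq hδ hX
  have hin : (∮ z in C(0, r), resolvent X z) = 0 := by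
    have hd : ∀ z : ℂ, ‖z‖ ≤ r → DifferentiableAt ℂ (resolvent X) z := fun z hz =>
      differentiableAt_resolvent fun hs => by linarith [(h4 z hs).1]
    refine Complex.circleIntegral_eq_zero_of_differentiable_on_off_countable (by linarith)
      Set.countable_empty (fun z hz => ?_) fun z hz => ?_
    · exact (hd z (by simpa using hz)).continuousAt.continuousWithinAt
    · exact hd z (by simpa using (Metric.ball_subset_closedBall hz.1))
  have hd : ∀ z : ℂ, R ≤ ‖z‖ → DifferentiableAt ℂ (resolvent X) z := fun z hz =>
    differentiableAt_resolvent fun hs => by linarith [(h4 z hs).2]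
  have hout : (∮ z in C(0, R), resolvent X z) = (2 * Real.pi * Complex.I : ℂ) • 1 := by
    rw [← sub_eq_zero, ← norm_eq_zero]
    refine le_antisymm (le_of_forall_gt_imp_ge_of_dense fun ε hε => ?_) (norm_nonneg _)
    have hlim := (spectrum.resolvent_tendsto_cobounded (𝕜 := ℂ) X).norm.mul_const
      (2 * Real.pi * ‖X‖)
    rw [norm_zero, zero_mul] at hlim
    obtain ⟨t, -, ht⟩ := (Filter.hasBasis_cobounded_norm (E := ℂ)).eventually_iff.mp
      (hlim.eventually (gt_mem_nhds hε))
    set ρ := max R t with hρ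
    have hρ0 : 0 < ρ := by linarith [le_max_left R t]
    have e1 : (∮ z in C(0, ρ), resolvent X z) = ∮ z in C(0, R), resolvent X z := by
      refine Complex.circleIntegral_eq_of_differentiable_on_annulus_off_countable
        (by linarith) (le_max_left _ _) Set.countable_empty (fun z hz => ?_) fun z hz => ?_
      · simp only [Set.mem_sdiff, Metric.mem_closedBall, Metric.mem_ball, dist_zero_right,
          not_lt] at hz
        exact (hd z hz.2).continuousAt.continuousWithinAt
      · simp only [Set.sdiff_empty, Set.mem_sdiff, Metric.mem_closedBall, Metric.mem_ball,
          dist_zero_right, not_le] at hz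
        exact hd z hz.2.le
    have hs : ∀ z ∈ Metric.sphere (0 : ℂ) ρ, R ≤ ‖z‖ ∧ t ≤ ‖z‖ ∧ z ≠ 0 := fun z hz => by
      rw [mem_sphere_zero_iff_norm] at hz
      exact ⟨hz ▸ le_max_left _ _, hz ▸ le_max_right _ _, norm_pos_iff.mp (hz ▸ hρ0)⟩
    have e2 : (∮ z in C(0, ρ), (z - 0)⁻¹ • (1 : H →L[ℂ] H)) = (2 * Real.pi * Complex.I : ℂ) • 1 := by
      rw [circleIntegral.integral_smul_const, circleIntegral.integral_sub_center_inv _ hρ0.ne']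
    have hci : ContinuousOn (fun z : ℂ => (z - 0)⁻¹) (Metric.sphere (0 : ℂ) ρ) :=
      (continuousOn_id.sub continuousOn_const).inv₀ fun z hz => by simpa using (hs z hz).2.2
    rw [← e1, ← e2, ← circleIntegral.integral_sub]
    -- The constant is chosen so that multiplying by the length 2πρ gives exactly ε.
    · refine (circleIntegral.norm_integral_le_of_norm_le_const (C := ρ⁻¹ * (ε / (2 * Real.pi)))
        hρ0.le fun z hz => ?_).trans ?_
      · have hz' := hs z hz
        have e3 : resolvent X z - (z - 0)⁻¹ • (1 : H →L[ℂ] H) =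
            z⁻¹ • (X * resolvent X z) := by
          rw [sub_zero, sub_eq_iff_eq_add', ← smul_add, ← smul_resolvent_eq', smul_smul,
            inv_mul_cancel₀ hz'.2.2, one_smul]
          exact fun hs => by linarith [(h4 z hs).2, hz'.1]
        rw [e3, norm_smul, norm_inv, mem_sphere_zero_iff_norm.mp hz]
        gcongr
        have := ht hz'.2.1
        rw [le_div_iff₀ (by positivity)]
        calc _ ≤ ‖X‖ * ‖resolvent X z‖ * (2 * Real.pi) := by gcongr; exact norm_mul_le _ _
          _ ≤ ε := by linarith
      · field_simp
        exact le_rfl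
    · exact ContinuousOn.circleIntegrable hρ0.le fun z hz =>
        (hd z (hs z hz).1).continuousAt.continuousWithinAt
    · exact ContinuousOn.circleIntegrable hρ0.le (hci.smul continuousOn_const)
  simp only [scalarCalc, one_smul, contourIntegral, h5, boundaryIntegral]
  rw [hin, hout, sub_zero, smul_smul, inv_mul_cancel₀ Complex.two_pi_I_ne_zero, one_smul]

theorem scalarCalc_const (c : ℂ) : scalarCalc δ (fun _ => c) X = c • 1 := by
  simpa [scalarCalc_one hδ0 hδ hX] using scalarCalc_const_mul (δ := δ) (X := X) c fun _ => 1

theorem scalarCalc_id : scalarCalc δ (fun z => z) X = X := by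
  simpa [scalarCalc_one hδ0 hδ hX] using
    scalarCalc_id_mul hδ0 hδ hX (φ := fun _ => 1) (differentiableOn_const _)

omit hδ [CompleteSpace H] in
theorem isUnit_of_spectrum_subset : IsUnit X := by
  have h : (0 : ℂ) ∉ spectrum ℂ X := fun h => ne_zero_of_mem_annulus hδ0.le (hX h) rfl
  simpa using spectrum.notMem_iff.mp h

theorem scalarCalc_div_mul {φ : ℂ → ℂ} (hφ : DifferentiableOn ℂ φ (annulus δ)) :
    scalarCalc δ (fun z => δ / z * φ z) X =
      ((δ : ℂ) • Ring.inverse X) * scalarCalc δ φ X := by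
  have hd : DifferentiableOn ℂ (fun z : ℂ => (δ : ℂ) / z * φ z) (annulus δ) :=
    ((differentiableOn_const _).div differentiableOn_id
      fun z hz => ne_zero_of_mem_annulus hδ0.le hz).mul hφ
  have h1 := scalarCalc_id_mul hδ0 hδ hX hd
  have h2 : scalarCalc δ (fun z => z * (δ / z * φ z)) X = (δ : ℂ) • scalarCalc δ φ X := by
    rw [← scalarCalc_const_mul]
    refine scalarCalc_congr hδ0 hδ hX fun z hz => ?_
    have := ne_zero_of_mem_annulus hδ0.le hz
    field_simp
  rw [smul_mul_assoc, ← mul_smul_comm, ← h2, h1, ← mul_assoc,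
    Ring.inverse_mul_cancel _ (isUnit_of_spectrum_subset hδ0 hX), one_mul]

theorem scalarCalc_div : scalarCalc δ (fun z => δ / z) X = (δ : ℂ) • Ring.inverse X := by
  simpa [scalarCalc_one hδ0 hδ hX] using
    scalarCalc_div_mul hδ0 hδ hX (φ := fun _ => 1) (differentiableOn_const _)

/-- Write φ(z) = g(z)(z - l) + φ(l) with g the holomorphic difference quotient `dslope φ l`; the
first term becomes g(X)(X - l), which kills `k`. -/
theorem scalarCalc_apply_eigenvector {φ : ℂ → ℂ} (hφ : DifferentiableOn ℂ φ (annulus δ)) {l : ℂ}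
    (hl : l ∈ annulus δ) {k : H} (hk : X k = l • k) : scalarCalc δ φ X k = φ l • k := by
  have hd : DifferentiableOn ℂ (dslope φ l) (annulus δ) :=
    (Complex.differentiableOn_dslope ((isOpen_annulus δ).mem_nhds hl)).mpr hφ
  have h1 := scalarCalc_mul_id hδ0 hδ hX hd
  have h2 : scalarCalc δ φ X =
      scalarCalc δ (fun z => dslope φ l z * z + ((-l) * dslope φ l z + φ l)) X := by
    refine scalarCalc_congr hδ0 hδ hX fun z _ => ?_
    have := sub_smul_dslope φ l z
    simp only [smul_eq_mul] at this
    linear_combination -this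
  rw [h2, scalarCalc_add hδ0 hδ hX (φ := fun z => dslope φ l z * z)
    (ψ := fun z => -l * dslope φ l z + φ l)
      (hd.mul differentiableOn_id) ((hd.const_mul _).add (differentiableOn_const _)),
    scalarCalc_add hδ0 hδ hX (φ := fun z => -l * dslope φ l z) (ψ := fun _ => φ l) (hd.const_mul _)
      (differentiableOn_const _), h1,
    scalarCalc_const_mul, scalarCalc_const hδ0 hδ hX]
  simp [hk]

end Calculus

/-! ### Realizations: unitary colligations with state operator `E(z)` -/

section Realization

/-- This is isometry of W ⊗ 1 on ℂ^κ ⊗ H. The case H = ℂ serves the pointwise identities, general H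
those in the functional calculus. -/
theorem sum_inner_mulVec_eq {κ : Type*} [Fintype κ] [DecidableEq κ] {W : Matrix κ κ ℂ}
    (hW : W.conjTranspose * W = 1) {H : Type*} [NormedAddCommGroup H] [InnerProductSpace ℂ H]
    (x y : κ → H) :
    ∑ i, inner ℂ (∑ j, W i j • x j) (∑ k, W i k • y k) = ∑ j, inner ℂ (x j) (y j) := by
  have h : ∀ j k, ∑ i, conj (W i j) * W i k = if j = k then 1 else 0 := fun j k => by
    have := congrFun (congrFun hW j) k
    simpa [Matrix.mul_apply, Matrix.one_apply] using this
  simp only [sum_inner, inner_sum, inner_smul_left, inner_smul_right]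
  rw [Finset.sum_comm]
  refine Finset.sum_congr rfl fun k _ => ?_
  simp only [Finset.mul_sum]
  rw [Finset.sum_comm]
  have : ∀ j, ∑ i, W i k * (conj (W i j) * inner ℂ (x j) (y k)) =
      (if j = k then 1 else 0) * inner ℂ (x j) (y k) := fun j => by
    rw [← h j k, Finset.sum_mul]
    exact Finset.sum_congr rfl fun i _ => by ring
  simp [this]

variable {α β : Type*}

/-- The diagonal entries `z` and `δ/z` of the pencil. -/
noncomputable def pencilEntry (δ : ℝ) (z : ℂ) : α ⊕ β → ℂ := Sum.elim (fun _ => z) fun _ => δ / z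

theorem norm_pencilEntry_lt {δ : ℝ} (hδ : 0 < δ) {z : ℂ} (hz : z ∈ annulus δ) (k : α ⊕ β) :
    ‖pencilEntry δ z k‖ < 1 := by
  cases k with
  | inl a => exact hz.2
  | inr b =>
    have : 0 < ‖z‖ := hδ.trans hz.1
    simp only [pencilEntry, Sum.elim_inr, norm_div, Complex.norm_real, Real.norm_eq_abs,
      abs_of_pos hδ]
    exact (div_lt_one this).mpr hz.1

theorem differentiableOn_pencilEntry {δ : ℝ} (hδ : 0 < δ) (k : α ⊕ β) :
    DifferentiableOn ℂ (fun z => pencilEntry δ z k) (annulus δ) := by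
  cases k with
  | inl a => exact differentiableOn_id
  | inr b =>
    change DifferentiableOn ℂ (fun z : ℂ => (δ : ℂ) / z) _
    exact (differentiableOn_const _).div differentiableOn_id
      fun z hz => ne_zero_of_mem_annulus hδ.le hz

variable [Fintype α] [Fintype β]

/-- `(φ(z), u(z)) = W (1, E(z) u(z))` on the annulus. -/
def IsRealization (δ : ℝ) (W : Matrix (Option (α ⊕ β)) (Option (α ⊕ β)) ℂ) (φ : ℂ → ℂ)
    (u : α ⊕ β → ℂ → ℂ) : Prop :=
  DifferentiableOn ℂ φ (annulus δ) ∧ (∀ k, DifferentiableOn ℂ (u k) (annulus δ)) ∧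
    ∀ z ∈ annulus δ, ∀ i : Option (α ⊕ β), i.elim (φ z) (fun k => u k z) =
      ∑ j : Option (α ⊕ β), W i j * j.elim 1 fun k => pencilEntry δ z k * u k z

variable [DecidableEq α] [DecidableEq β] {W : Matrix (Option (α ⊕ β)) (Option (α ⊕ β)) ℂ}
  {δ : ℝ}

/-- Isometry gives |w|² + ‖v‖² = ‖E(z)v‖², while E(z) is a strict contraction on the annulus. This
gives both uniqueness of realizations and solvability of the state equation. -/
theorem eq_zero_of_eq_mulVec (hδ : 0 < δ) (hW : W.conjTranspose * W = 1) {z : ℂ}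
    (hz : z ∈ annulus δ) {w : ℂ} {v : α ⊕ β → ℂ}
    (h : ∀ i : Option (α ⊕ β), i.elim w v =
      ∑ j : Option (α ⊕ β), W i j * j.elim 0 fun k => pencilEntry δ z k * v k) :
    w = 0 ∧ v = 0 := by
  set x : Option (α ⊕ β) → ℂ := fun j => j.elim 0 fun k => pencilEntry δ z k * v k
  have key := congrArg Complex.re (sum_inner_mulVec_eq hW x x)
  simp only [smul_eq_mul] at key
  rw [Finset.sum_congr rfl fun i _ => by rw [← h i]] at key
  simp only [Fintype.sum_option, x, Option.elim, Complex.add_re, Complex.re_sum] at key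
  simp only [← RCLike.re_eq_complex_re, inner_self_eq_norm_sq, norm_mul, mul_pow, norm_zero] at key
  have hle : ∀ k, ‖pencilEntry δ z k‖ ^ 2 * ‖v k‖ ^ 2 ≤ ‖v k‖ ^ 2 := fun k =>
    mul_le_of_le_one_left (by positivity)
      (pow_le_one₀ (norm_nonneg _) (norm_pencilEntry_lt hδ hz k).le)
  have hle' := Finset.sum_le_sum fun k (_ : k ∈ Finset.univ) => hle k
  have hw : w = 0 := by
    rw [← norm_eq_zero, ← sq_eq_zero_iff]
    nlinarith [sq_nonneg ‖w‖]
  refine ⟨hw, funext fun k => ?_⟩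
  have heq := (Finset.sum_eq_sum_iff_of_le fun k (_ : k ∈ Finset.univ) => hle k).mp
    (le_antisymm hle' (by nlinarith [sq_nonneg ‖w‖])) k (Finset.mem_univ k)
  by_contra hv
  have h1 : 0 < ‖v k‖ ^ 2 := pow_pos (norm_pos_iff.mpr hv) 2
  have h2 : ‖pencilEntry δ z k‖ ^ 2 < 1 :=
    pow_lt_one₀ (norm_nonneg _) (norm_pencilEntry_lt hδ hz k) two_ne_zero
  nlinarith

theorem IsRealization.unique (hδ : 0 < δ) (hW : W.conjTranspose * W = 1) {φ : ℂ → ℂ}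
    {u : α ⊕ β → ℂ → ℂ} (hu : IsRealization δ W φ u) {z : ℂ} (hz : z ∈ annulus δ) {w : ℂ}
    {v : α ⊕ β → ℂ} (h : ∀ i : Option (α ⊕ β), i.elim w v =
      ∑ j : Option (α ⊕ β), W i j * j.elim 1 fun k => pencilEntry δ z k * v k) :
    φ z = w := by
  refine (sub_eq_zero.mp (eq_zero_of_eq_mulVec hδ hW hz (w := w - φ z)
    (v := fun k => v k - u k z) fun i => ?_).1).symm
  have h1 := h i
  have h2 := hu.2.2 z hz i
  rw [show i.elim (w - φ z) (fun k => v k - u k z) =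
    i.elim w v - i.elim (φ z) (fun k => u k z) by cases i <;> rfl, h1, h2,
    ← Finset.sum_sub_distrib]
  refine Finset.sum_congr rfl fun j _ => ?_
  cases j <;> simp only [Option.elim] <;> ring

open Polynomial in
-- With D the state block of W, the state equation has matrix 1 - D E(z), which is injective by the
-- homogeneous case. Cramer's rule then solves it rationally in z.
theorem exists_isRealization (hδ : 0 < δ) (hW : W.conjTranspose * W = 1) :
    ∃ φ u, IsRealization δ W φ u ∧ IsRationalOn (annulus δ) φ := by
  -- Multiplying the pencil entries z and δ/z by z clears the denominator, so that N = z(1 - D E(z))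
  -- is a polynomial matrix.
  let p : α ⊕ β → ℂ[X] := Sum.elim (fun _ => X ^ 2) fun _ => C (δ : ℂ)
  let N : Matrix (α ⊕ β) (α ⊕ β) ℂ[X] :=
    Matrix.of fun i k => (if i = k then X else 0) - C (W (some i) (some k)) * p k
  have hp : ∀ z ∈ annulus δ, ∀ k, (p k).eval z = z * pencilEntry δ z k := by
    rintro z hz (a | b)
    · simp [p, pencilEntry, sq]
    · simp [p, pencilEntry, mul_div_cancel₀ _ (ne_zero_of_mem_annulus hδ.le hz)]
  have hN : ∀ z : ℂ, ∀ (v : α ⊕ β → ℂ) i, ((N.map (eval z)).mulVec v) i =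
      z * v i - ∑ k, W (some i) (some k) * (p k).eval z * v k := fun z v i => by
    simp only [Matrix.mulVec, dotProduct, N, Matrix.map_apply, Matrix.of_apply, eval_sub, eval_mul,
      eval_C, sub_mul, Finset.sum_sub_distrib]
    congr 1
    rw [Finset.sum_eq_single i] <;> simp +contextual [eq_comm]
  have hdet : ∀ z, N.det.eval z = (N.map (eval z)).det := fun z => by
    simpa using RingHom.map_det (evalRingHom z) N
  have hadj : ∀ z i k, (N.adjugate i k).eval z = (N.map (eval z)).adjugate i k := fun z i k =>
    congrFun (congrFun (RingHom.map_adjugate (evalRingHom z) N) i) k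
  have hne : ∀ z ∈ annulus δ, N.det.eval z ≠ 0 := fun z hz h0 => by
    rw [hdet] at h0
    obtain ⟨v, hv, hv0⟩ := Matrix.exists_mulVec_eq_zero_iff.mpr h0
    have hz0 := ne_zero_of_mem_annulus hδ.le hz
    refine hv (eq_zero_of_eq_mulVec hδ hW hz (v := v)
      (w := ∑ k, W none (some k) * (pencilEntry δ z k * v k)) fun i => ?_).2
    cases i with
    | none => simp
    | some i =>
      have := congrFun hv0 i
      rw [hN, Pi.zero_apply, sub_eq_zero] at this
      refine mul_left_cancel₀ hz0 ?_
      simp only [Option.elim, this, Fintype.sum_option, mul_zero, zero_add, Finset.mul_sum,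
        hp z hz]
      exact Finset.sum_congr rfl fun k _ => by ring
  let q : α ⊕ β → ℂ[X] := fun i => ∑ k, N.adjugate i k * C (W (some k) none)
  let u : α ⊕ β → ℂ → ℂ := fun i z => z * (q i).eval z / N.det.eval z
  let P : ℂ[X] := C (W none none) * N.det + ∑ k, C (W none (some k)) * p k * q k
  have hu : ∀ z ∈ annulus δ, ∀ i, u i z = W (some i) none +
      ∑ k, W (some i) (some k) * (pencilEntry δ z k * u k z) := fun z hz i => by
    have hz0 := ne_zero_of_mem_annulus hδ.le hz
    have hd := hne z hz
    have h1 : (N.map (eval z)).mulVec (fun k => (q k).eval z) =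
        fun k => N.det.eval z * W (some k) none := by
      have : (fun k => (q k).eval z) =
          (N.map (eval z)).adjugate.mulVec fun k => W (some k) none := by
        ext k
        simp [q, Matrix.mulVec, dotProduct, eval_finsetSum, hadj]
      rw [this, Matrix.mulVec_mulVec, Matrix.mul_adjugate, ← hdet, Matrix.smul_mulVec,
        Matrix.one_mulVec]
      rfl
    have h2 := congrFun h1 i
    rw [hN] at h2
    have h3 : z * (q i).eval z = N.det.eval z * W (some i) none +
      ∑ k, W (some i) (some k) * (p k).eval z * (q k).eval z := by linear_combination h2
    simp only [u]
    rw [h3, add_div, mul_div_cancel_left₀ _ hd, Finset.sum_div]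
    congr 1
    refine Finset.sum_congr rfl fun k _ => ?_
    rw [hp z hz]
    ring
  refine ⟨fun z => P.eval z / N.det.eval z, u, ⟨?_, fun k => ?_, fun z hz i => ?_⟩, P, N.det,
    fun z hz => ⟨hne z hz, rfl⟩⟩
  · exact P.differentiable.differentiableOn.div N.det.differentiable.differentiableOn hne
  · exact (differentiableOn_id.mul (q k).differentiable.differentiableOn).div
      N.det.differentiable.differentiableOn hne
  · cases i with
    | some i => simpa using hu z hz i
    | none =>
      simp only [Option.elim, Fintype.sum_option, P, u, eval_add, eval_mul, eval_C,
        eval_finsetSum, add_div, mul_one]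
      rw [mul_div_cancel_right₀ _ (hne z hz), Finset.sum_div]
      congr 1
      refine Finset.sum_congr rfl fun k _ => ?_
      rw [hp z hz]
      ring

/-! ### Realizations evaluated at operators -/

section OperatorIdentities

variable {φ : ℂ → ℂ} {u : α ⊕ β → ℂ → ℂ} {H : Type*} [NormedAddCommGroup H]
  [InnerProductSpace ℂ H] [CompleteSpace H] {X : H →L[ℂ] H}

omit [Fintype α] [Fintype β] [DecidableEq α] [DecidableEq β] in
theorem scalarCalc_pencilEntry_mul (hδ0 : 0 < δ) (hδ : δ < 1) (hX : spectrum ℂ X ⊆ annulus δ)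
    {f : ℂ → ℂ} (hf : DifferentiableOn ℂ f (annulus δ)) (k : α ⊕ β) :
    scalarCalc δ (fun z => pencilEntry δ z k * f z) X =
      scalarCalc δ (fun z => pencilEntry δ z k) X * scalarCalc δ f X := by
  cases k with
  | inl a =>
    simp only [pencilEntry, Sum.elim_inl]
    rw [scalarCalc_id_mul hδ0 hδ hX hf, scalarCalc_id hδ0 hδ hX]
  | inr b =>
    simp only [pencilEntry, Sum.elim_inr]
    rw [scalarCalc_div_mul hδ0 hδ hX hf, scalarCalc_div hδ0 hδ hX]

omit [Fintype α] [Fintype β] [DecidableEq α] [DecidableEq β] in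
theorem norm_scalarCalc_pencilEntry_le (hδ0 : 0 < δ) (hδ : δ < 1) (hX : DPFamily δ X)
    (k : α ⊕ β) : ‖scalarCalc δ (fun z => pencilEntry δ z k) X‖ ≤ 1 := by
  cases k with
  | inl a =>
    simp only [pencilEntry, Sum.elim_inl]
    rw [scalarCalc_id hδ0 hδ hX.2]
    exact hX.1.1
  | inr b =>
    simp only [pencilEntry, Sum.elim_inr]
    rw [scalarCalc_div hδ0 hδ hX.2, norm_smul, Complex.norm_real, Real.norm_eq_abs,
      abs_of_pos hδ0]
    calc δ * ‖Ring.inverse X‖ ≤ δ * (1 / δ) := by gcongr; exact hX.1.2.2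
      _ = 1 := by field_simp

/-- The calculus turns (φ, u) = W(1, E u) into the same equation between operators, and W acts
isometrically on tuples in H. Of multiplicativity only the factors z and δ/z are needed. -/
theorem IsRealization.inner_scalarCalc (hδ0 : 0 < δ) (hδ : δ < 1)
    (hW : W.conjTranspose * W = 1) (hu : IsRealization δ W φ u)
    (hX : spectrum ℂ X ⊆ annulus δ) (h h' : H) :
    inner ℂ (scalarCalc δ φ X h) (scalarCalc δ φ X h') +
        ∑ k, inner ℂ (scalarCalc δ (u k) X h) (scalarCalc δ (u k) X h') =
      inner ℂ h h' + ∑ k,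
        inner ℂ (scalarCalc δ (fun z => pencilEntry δ z k) X (scalarCalc δ (u k) X h))
          (scalarCalc δ (fun z => pencilEntry δ z k) X (scalarCalc δ (u k) X h')) := by
  obtain ⟨h1, h2, h3⟩ := hu
  have key : ∀ i : Option (α ⊕ β), i.elim (scalarCalc δ φ X) (fun k => scalarCalc δ (u k) X) =
      ∑ j : Option (α ⊕ β), W i j • j.elim (1 : H →L[ℂ] H) fun k =>
        scalarCalc δ (fun z => pencilEntry δ z k) X * scalarCalc δ (u k) X := fun i => by
    have e1 : i.elim (scalarCalc δ φ X) (fun k => scalarCalc δ (u k) X) =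
        scalarCalc δ (fun z => ∑ j : Option (α ⊕ β),
          W i j * j.elim 1 fun k => pencilEntry δ z k * u k z) X := by
      cases i with
      | none => exact scalarCalc_congr hδ0 hδ hX fun z hz => h3 z hz none
      | some k => exact scalarCalc_congr hδ0 hδ hX fun z hz => h3 z hz (some k)
    rw [e1, scalarCalc_sum hδ0 hδ hX]
    · refine Finset.sum_congr rfl fun j _ => ?_
      rw [scalarCalc_const_mul]
      cases j with
      | none => simp only [Option.elim]; rw [scalarCalc_one hδ0 hδ hX]
      | some k => simp only [Option.elim]; rw [scalarCalc_pencilEntry_mul hδ0 hδ hX (h2 k)]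
    · intro j _
      refine DifferentiableOn.const_mul ?_ _
      cases j with
      | none => exact differentiableOn_const _
      | some k => exact (differentiableOn_pencilEntry hδ0 k).mul (h2 k)
  let x : H → Option (α ⊕ β) → H := fun h j => j.elim h fun k =>
    scalarCalc δ (fun z => pencilEntry δ z k) X (scalarCalc δ (u k) X h)
  have hx : ∀ h i, ∑ j, W i j • x h j =
      i.elim (scalarCalc δ φ X h) (fun k => scalarCalc δ (u k) X h) := fun h i => by
    have := congrArg (fun A : H →L[ℂ] H => A h) (key i)
    simp only [sum_apply, smul_apply] at this
    have e : ∀ j : Option (α ⊕ β), (j.elim (1 : H →L[ℂ] H) fun k =>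
        scalarCalc δ (fun z => pencilEntry δ z k) X * scalarCalc δ (u k) X) h = x h j := by
      rintro (_ | j) <;> rfl
    simp only [e] at this
    rw [← this]
    cases i <;> rfl
  simpa [hx, Fintype.sum_option, x] using sum_inner_mulVec_eq hW (x h) (x h')

/-- The preceding identity with h = h' gives ‖φ(X)h‖² = ‖h‖² minus terms ‖u_k(X)h‖² -
‖E_k(X)u_k(X)h‖². These are nonnegative because E_k(X) is X or δX⁻¹, a contraction. -/
theorem IsRealization.norm_scalarCalc_le (hδ0 : 0 < δ) (hδ : δ < 1)
    (hW : W.conjTranspose * W = 1) (hu : IsRealization δ W φ u) (hX : DPFamily δ X) :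
    ‖scalarCalc δ φ X‖ ≤ 1 := by
  refine ContinuousLinearMap.opNorm_le_bound _ zero_le_one fun h => ?_
  have key := congrArg Complex.re (hu.inner_scalarCalc hδ0 hδ hW hX.2 h h)
  simp only [Complex.add_re, Complex.re_sum] at key
  simp only [← RCLike.re_eq_complex_re, inner_self_eq_norm_sq] at key
  have hle := Finset.sum_le_sum fun k (_ : k ∈ (Finset.univ : Finset (α ⊕ β))) =>
    pow_le_pow_left₀ (norm_nonneg _)
      ((ContinuousLinearMap.le_opNorm (scalarCalc δ (fun z => pencilEntry δ z k) X)
        (scalarCalc δ (u k) X h)).trans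
          (mul_le_of_le_one_left (norm_nonneg _) (norm_scalarCalc_pencilEntry_le hδ0 hδ hX k))) 2
  rw [one_mul]
  exact le_of_sq_le_sq (by linarith) (norm_nonneg _)

end OperatorIdentities

theorem IsRealization.dpSchur (hδ0 : 0 < δ) (hδ : δ < 1) (hW : W.conjTranspose * W = 1)
    {φ : ℂ → ℂ} {u : α ⊕ β → ℂ → ℂ} (hu : IsRealization δ W φ u) : DPSchur δ φ := by
  refine ⟨hu.1, sSup_le ?_⟩
  rintro _ ⟨H, _, _, _, X, hX, rfl⟩
  rw [← ofReal_norm, ← ENNReal.ofReal_one]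
  exact ENNReal.ofReal_le_ofReal (hu.norm_scalarCalc_le hδ0 hδ hW hX)

end Realization

/-! ### The calculus for vector- and operator-valued functions -/

section TensorCalculus

variable {M H : Type*} [NormedAddCommGroup M] [InnerProductSpace ℂ M] [FiniteDimensional ℂ M]
  [NormedAddCommGroup H] [InnerProductSpace ℂ H] [FiniteDimensional ℂ H]
  [CompleteSpace H] {T : H →L[ℂ] H} {δ : ℝ}

/-- Evaluation at `h` and the maps A ↦ b_k ⊗ A h are continuous and linear, so they pass through the
contour integral and reduce u(T) to scalar calculi. -/
theorem vectorCalc_eq_sum (hδ0 : 0 < δ) (hδ : δ < 1) (hT : spectrum ℂ T ⊆ annulus δ)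
    {κ : Type*} [Fintype κ] {f : κ → ℂ → ℂ} {b : κ → M} {u : ℂ → M}
    (hf : ∀ k, DifferentiableOn ℂ (f k) (annulus δ)) (hu : ∀ z, u z = ∑ k, f k z • b k) (h : H) :
    vectorCalc δ u T h = ∑ k, b k ⊗ₜ[ℂ] scalarCalc δ (f k) T h := by
  have huc : ContinuousOn u (annulus δ) := by
    rw [show u = fun z => ∑ k, f k z • b k from funext hu]
    exact continuousOn_finsetSum _ fun k _ => (hf k).continuousOn.smul continuousOn_const
  have hr : ContinuousOn (resolvent T) (annulus δ \ spectrum ℂ T) := fun z hz =>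
    (differentiableAt_resolvent hz.2).continuousAt.continuousWithinAt
  have h1 := contourIntegral_clm hδ0 hδ hT (ContinuousLinearMap.apply ℂ (M ⊗[ℂ] H) h)
    (((TensorProduct.mkL ℂ M H).continuous.comp_continuousOn
      (huc.mono Set.sdiff_subset)).clm_comp hr)
  let L : κ → (H →L[ℂ] H) →L[ℂ] (M ⊗[ℂ] H) := fun k =>
    TensorProduct.mkL ℂ M H (b k) ∘L ContinuousLinearMap.apply ℂ _ h
  have h2 : ∀ k, contourIntegral δ T (fun z => L k (f k z • resolvent T z)) =
      b k ⊗ₜ[ℂ] scalarCalc δ (f k) T h := fun k =>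
    contourIntegral_clm hδ0 hδ hT (L k) (continuousOn_smul_resolvent (hf k))
  refine h1.symm.trans ?_
  simp only [← h2]
  refine Eq.trans ?_ (contourIntegral_sum hδ0 hδ hT Finset.univ
    (G := fun k z => L k (f k z • resolvent T z)) fun k _ =>
      (L k).continuous.comp_continuousOn (continuousOn_smul_resolvent (hf k)))
  congr 1
  funext z
  simp [L, hu, TensorProduct.smul_tmul']

omit [CompleteSpace H] in
theorem continuousOn_mapL {F : ℂ → M →L[ℂ] M} {G : ℂ → H →L[ℂ] H} {s : Set ℂ}
    (hF : ContinuousOn F s) (hG : ContinuousOn G s) :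
    ContinuousOn (fun z => TensorProduct.mapL (F z) (G z)) s := by
  refine continuousOn_clm_apply.mpr fun t => ?_
  induction t with
  | zero => simpa using continuousOn_const
  | tmul m x =>
    have := ((TensorProduct.mkL ℂ M H).continuous.comp_continuousOn
      (hF.clm_apply (continuousOn_const (c := m)))).clm_apply (hG.clm_apply (continuousOn_const (c := x)))
    exact this
  | add t t' ht ht' =>
    simp only [map_add]
    exact ht.add ht'

theorem operatorCalc_tmul (hδ0 : 0 < δ) (hδ : δ < 1) (hT : spectrum ℂ T ⊆ annulus δ)
    {F : ℂ → M →L[ℂ] M} (hF : ContinuousOn F (annulus δ)) {g : ℂ → ℂ}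
    (hg : DifferentiableOn ℂ g (annulus δ)) {e : M} (he : ∀ z, F z e = g z • e) (h : H) :
    operatorCalc δ F T (e ⊗ₜ[ℂ] h) = e ⊗ₜ[ℂ] scalarCalc δ g T h := by
  let L₁ : (M ⊗[ℂ] H →L[ℂ] M ⊗[ℂ] H) →L[ℂ] (M ⊗[ℂ] H) :=
    ContinuousLinearMap.apply ℂ _ (e ⊗ₜ[ℂ] h)
  let L₂ : (H →L[ℂ] H) →L[ℂ] (M ⊗[ℂ] H) :=
    TensorProduct.mkL ℂ M H e ∘L ContinuousLinearMap.apply ℂ _ h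
  have hr : ContinuousOn (resolvent T) (annulus δ \ spectrum ℂ T) := fun z hz =>
    (differentiableAt_resolvent hz.2).continuousAt.continuousWithinAt
  have h1 := contourIntegral_clm hδ0 hδ hT L₁ (continuousOn_mapL
    (hF.mono Set.sdiff_subset) hr)
  have h2 := contourIntegral_clm hδ0 hδ hT L₂ (continuousOn_smul_resolvent hg)
  refine h1.symm.trans (Eq.trans ?_ h2)
  congr 1
  funext z
  change F z e ⊗ₜ[ℂ] resolvent T z h = e ⊗ₜ[ℂ] (g z • resolvent T z h)
  rw [he, TensorProduct.smul_tmul]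

end TensorCalculus

/-! ### The model space of a realization -/

section ModelSpace

variable {α β : Type*} [Fintype α] [Fintype β]

/-- The state space `ℂ^α ⊕ ℂ^β`. -/
abbrev StateSpace (α β : Type*) [Fintype α] [Fintype β] : Type _ :=
  WithLp 2 (EuclideanSpace ℂ α × EuclideanSpace ℂ β)

/-- The vector of the state space with the given coordinates. -/
noncomputable def stateVec (v : α ⊕ β → ℂ) : StateSpace α β :=
  WithLp.toLp 2 (WithLp.toLp 2 fun a => v (.inl a), WithLp.toLp 2 fun b => v (.inr b))

theorem inner_stateVec (v w : α ⊕ β → ℂ) :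
    inner ℂ (stateVec v) (stateVec w) = ∑ k, conj (v k) * w k := by
  simp [stateVec, WithLp.prod_inner_apply, PiLp.inner_apply, Fintype.sum_sum_type, mul_comm]

theorem stateVec_eq_sum [DecidableEq α] [DecidableEq β] (v : α ⊕ β → ℂ) :
    stateVec v = ∑ k, v k • stateVec (Pi.single k 1) := by
  refine ext_inner_left ℂ fun w => ?_
  have hw : w = stateVec (Sum.elim (fun a => w.fst a) fun b => w.snd b) := rfl
  rw [hw, inner_sum]
  simp only [inner_smul_right, inner_stateVec]
  refine Finset.sum_congr rfl fun k _ => ?_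
  rw [Finset.sum_eq_single k]
  · simp [mul_comm]
  · intro j _ hj
    simp [hj]
  · simp

theorem pencil_stateVec (δ : ℝ) (z : ℂ) (v : α ⊕ β → ℂ) :
    pencil _ _ δ z (stateVec v) = stateVec fun k => pencilEntry δ z k * v k := rfl

/-- `pencil M₁ M₂ 0 1` is diag(1, 0), the projection onto `M₁`; this form makes continuity in z
visible. -/
theorem pencil_eq (δ : ℝ) (z : ℂ) (M₁ M₂ : Type*) [NormedAddCommGroup M₁]
    [InnerProductSpace ℂ M₁] [NormedAddCommGroup M₂] [InnerProductSpace ℂ M₂] :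
    pencil M₁ M₂ δ z = z • pencil M₁ M₂ 0 1 + (δ / z) • (1 - pencil M₁ M₂ 0 1) := by
  refine ContinuousLinearMap.ext fun x => WithLp.ofLp_injective 2 (Prod.ext ?_ ?_)
  · simp [pencil]
  · simp [pencil]

omit [Fintype α] [Fintype β] in
theorem continuousOn_smul_add_div_smul {δ : ℝ} (hδ : 0 < δ) {V : Type*} [NormedAddCommGroup V]
    [NormedSpace ℂ V] (P Q : V) :
    ContinuousOn (fun z : ℂ => z • P + ((δ : ℂ) / z) • Q) (annulus δ) := by
  refine (continuousOn_id.smul continuousOn_const).add (ContinuousOn.smul ?_ continuousOn_const)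
  exact continuousOn_const.div continuousOn_id fun z hz => ne_zero_of_mem_annulus hδ.le hz

theorem continuousOn_pencil {δ : ℝ} (hδ : 0 < δ) {M₁ M₂ : Type*} [NormedAddCommGroup M₁]
    [InnerProductSpace ℂ M₁] [NormedAddCommGroup M₂] [InnerProductSpace ℂ M₂] :
    ContinuousOn (pencil M₁ M₂ δ) (annulus δ) := by
  rw [show pencil M₁ M₂ δ = _ from funext fun z => pencil_eq δ z M₁ M₂]
  exact continuousOn_smul_add_div_smul (V := WithLp 2 (M₁ × M₂) →L[ℂ] WithLp 2 (M₁ × M₂)) hδ _ _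

variable [DecidableEq α] [DecidableEq β] {W : Matrix (Option (α ⊕ β)) (Option (α ⊕ β)) ℂ}
  {δ : ℝ} {φ : ℂ → ℂ} {u : α ⊕ β → ℂ → ℂ}

theorem differentiableOn_stateVec {s : Set ℂ} (hu : ∀ k, DifferentiableOn ℂ (u k) s) :
    DifferentiableOn ℂ (fun z => stateVec fun k => u k z) s := by
  have : (fun z => stateVec fun k => u k z) =
      fun z => ∑ k, u k z • stateVec (α := α) (β := β) (Pi.single k 1) :=
    funext fun z => stateVec_eq_sum _
  rw [this]
  exact DifferentiableOn.fun_sum fun k _ => (hu k).smul_const _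

/-- Isometry of W applied to the vectors (1, E u) at the two points l and m gives the model formula
after rearrangement. -/
theorem IsRealization.isDPModel (hW : W.conjTranspose * W = 1) (hu : IsRealization δ W φ u) :
    IsDPModel δ φ fun z => stateVec fun k => u k z := by
  refine ⟨differentiableOn_stateVec hu.2.1, fun l hl m hm => ?_⟩
  have key := sum_inner_mulVec_eq hW
    (fun j => j.elim 1 fun k => pencilEntry δ m k * u k m)
    (fun j => j.elim 1 fun k => pencilEntry δ l k * u k l)
  simp only [smul_eq_mul] at key
  rw [Finset.sum_congr rfl fun i _ => by rw [← hu.2.2 l hl i, ← hu.2.2 m hm i]] at key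
  simp only [Fintype.sum_option, Option.elim, RCLike.inner_apply, map_one, mul_one] at key
  rw [sub_apply, inner_sub_right]
  simp only [ContinuousLinearMap.comp_apply, one_apply_eq_self,
    ContinuousLinearMap.adjoint_inner_right, pencil_stateVec, inner_stateVec]
  simp only [mul_comm (conj _)]
  linear_combination -key

/-! ### The model identity at an operator -/

section Tensor

variable {H : Type*} [NormedAddCommGroup H] [InnerProductSpace ℂ H] [FiniteDimensional ℂ H]
  [CompleteSpace H] {T : H →L[ℂ] H}

theorem vectorCalc_stateVec (hδ0 : 0 < δ) (hδ : δ < 1) (hT : spectrum ℂ T ⊆ annulus δ)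
    (hu : ∀ k, DifferentiableOn ℂ (u k) (annulus δ)) (h : H) :
    vectorCalc δ (fun z => stateVec fun k => u k z) T h =
      ∑ k, stateVec (Pi.single k 1) ⊗ₜ[ℂ] scalarCalc δ (u k) T h :=
  vectorCalc_eq_sum hδ0 hδ hT hu (fun _ => stateVec_eq_sum _) h

theorem operatorCalc_pencil_tmul (hδ0 : 0 < δ) (hδ : δ < 1) (hT : spectrum ℂ T ⊆ annulus δ)
    (k : α ⊕ β) (h : H) :
    operatorCalc δ (pencil (EuclideanSpace ℂ α) (EuclideanSpace ℂ β) δ) T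
        (stateVec (Pi.single k 1) ⊗ₜ[ℂ] h) =
      stateVec (Pi.single k 1) ⊗ₜ[ℂ] scalarCalc δ (fun z => pencilEntry δ z k) T h := by
  refine operatorCalc_tmul hδ0 hδ hT ?_ (differentiableOn_pencilEntry hδ0 k) (fun z => ?_) h
  · exact continuousOn_pencil hδ0
  · rw [pencil_stateVec, stateVec_eq_sum, Finset.sum_eq_single k]
    · simp
    · intro j _ hj
      simp [hj]
    · simp

omit [FiniteDimensional ℂ H] [CompleteSpace H] in
theorem inner_sum_stateVec_tmul (x y : α ⊕ β → H) :
    inner ℂ (∑ k, stateVec (Pi.single k 1) ⊗ₜ[ℂ] x k) (∑ k, stateVec (Pi.single k 1) ⊗ₜ[ℂ] y k) =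
      ∑ k, inner ℂ (x k) (y k) := by
  simp only [sum_inner, inner_sum, TensorProduct.inner_tmul, inner_stateVec]
  refine Finset.sum_congr rfl fun k _ => ?_
  rw [Finset.sum_eq_single k]
  · simp [Pi.single_apply]
  · intro j _ hj
    simp [Pi.single_apply, hj.symm]
  · simp

theorem IsRealization.one_sub_adjoint_comp (hδ0 : 0 < δ) (hδ : δ < 1)
    (hW : W.conjTranspose * W = 1) (hu : IsRealization δ W φ u) (hT : spectrum ℂ T ⊆ annulus δ) :
    1 - (scalarCalc δ φ T)† ∘L scalarCalc δ φ T =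
      (vectorCalc δ (fun z => stateVec fun k => u k z) T)† ∘L
        (1 - (operatorCalc δ (pencil (EuclideanSpace ℂ α) (EuclideanSpace ℂ β) δ) T)† ∘L
          operatorCalc δ (pencil (EuclideanSpace ℂ α) (EuclideanSpace ℂ β) δ) T) ∘L
        vectorCalc δ (fun z => stateVec fun k => u k z) T := by
  refine ContinuousLinearMap.ext fun y => ext_inner_left ℂ fun x => ?_
  have key := hu.inner_scalarCalc hδ0 hδ hW hT x y
  simp only [ContinuousLinearMap.comp_apply, ContinuousLinearMap.adjoint_inner_right,
    sub_apply, inner_sub_right, one_apply_eq_self]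
  simp only [vectorCalc_stateVec hδ0 hδ hT hu.2.1, map_sum, operatorCalc_pencil_tmul hδ0 hδ hT,
    inner_sum_stateVec_tmul]
  linear_combination -key

end Tensor

end ModelSpace

/-! ### The lurking isometry -/

theorem sum_mul_mul_mul {κ : Type*} [Fintype κ] (a b : ℂ) (f g : κ → ℂ) :
    ∑ k, a * f k * (b * g k) = a * b * ∑ k, f k * g k := by
  rw [Finset.mul_sum]
  exact Finset.sum_congr rfl fun k _ => by ring

/-- Equal Gram matrices make x_i ↦ y_i an isometry between spans; in finite dimension it extends to
a unitary of the whole space. -/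
theorem exists_unitary_mulVec_eq {ι κ : Type*} [Fintype ι] [DecidableEq ι] [Fintype κ]
    [DecidableEq κ] (x y : ι → κ → ℂ)
    (h : ∀ i j, ∑ k, conj (x i k) * x j k = ∑ k, conj (y i k) * y j k) :
    ∃ W : Matrix κ κ ℂ, W.conjTranspose * W = 1 ∧ ∀ j k, y j k = ∑ l, W k l * x j l := by
  let L : (ι → κ → ℂ) → (ι → ℂ) →ₗ[ℂ] EuclideanSpace ℂ κ := fun x =>
    Fintype.linearCombination ℂ fun i => (WithLp.toLp 2 (x i) : EuclideanSpace ℂ κ)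
  have hL : ∀ (x : ι → κ → ℂ) j, L x (Pi.single j 1) = WithLp.toLp 2 (x j) := fun x j => by
    simp [L, Fintype.linearCombination_apply_single]
  have hin : ∀ (x : ι → κ → ℂ) i j, inner ℂ (WithLp.toLp 2 (x i) : EuclideanSpace ℂ κ) (WithLp.toLp 2 (x j)) =
      ∑ k, conj (x i k) * x j k := fun x i j => by
    simp [PiLp.inner_apply, mul_comm]
  have hnorm : ∀ c, ‖L x c‖ = ‖L y c‖ := fun c => by
    have : (inner ℂ (L x c) (L x c) : ℂ) = inner ℂ (L y c) (L y c) := by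
      simp only [L, Fintype.linearCombination_apply, sum_inner, inner_sum, inner_smul_left,
        inner_smul_right, hin, h]
    rw [inner_self_eq_norm_sq_to_K, inner_self_eq_norm_sq_to_K] at this
    exact (pow_left_inj₀ (norm_nonneg _) (norm_nonneg _) two_ne_zero).mp (by exact_mod_cast this)
  -- `g` chooses coefficients linearly. The choice does not matter, since by `hnorm` the map `L y`
  -- vanishes on the kernel of `L x`.
  obtain ⟨g, hg⟩ := (L x).rangeRestrict.exists_rightInverse_of_surjective (L x).range_rangeRestrict
  have hg' : ∀ s : LinearMap.range (L x), L x (g s) = s := fun s =>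
    congrArg Subtype.val (LinearMap.congr_fun hg s)
  let V₀ : LinearMap.range (L x) →ₗᵢ[ℂ] EuclideanSpace ℂ κ :=
    { toLinearMap := L y ∘ₗ g
      norm_map' := fun s => by
        change ‖L y (g s)‖ = ‖(s : EuclideanSpace ℂ κ)‖
        rw [← hnorm, hg'] }
  let V : EuclideanSpace ℂ κ →ₗᵢ[ℂ] EuclideanSpace ℂ κ := V₀.extend
  have hV : ∀ j, V (WithLp.toLp 2 (x j)) = WithLp.toLp 2 (y j) := fun j => by
    have hm : (WithLp.toLp 2 (x j) : EuclideanSpace ℂ κ) ∈ LinearMap.range (L x) := ⟨_, hL x j⟩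
    have h1 : V (WithLp.toLp 2 (x j)) = L y (g ⟨_, hm⟩) := V₀.extend_apply ⟨_, hm⟩
    rw [h1, ← hL y j, ← sub_eq_zero, ← map_sub, ← norm_eq_zero, ← hnorm, map_sub, hg', hL,
      sub_self, norm_zero]
  refine ⟨Matrix.of fun k l => V (EuclideanSpace.single l 1) k, ?_, fun j k => ?_⟩
  · ext i j
    have := V.inner_map_map (EuclideanSpace.single i 1) (EuclideanSpace.single j (1 : ℂ))
    rw [PiLp.inner_apply] at this
    rw [PiLp.inner_apply] at this
    simpa [Matrix.mul_apply, Matrix.one_apply, mul_comm, Pi.single_apply, eq_comm] using this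
  · have hx : (WithLp.toLp 2 (x j) : EuclideanSpace ℂ κ) = ∑ l, x j l • EuclideanSpace.single l (1 : ℂ) := by
      ext k
      simp [Finset.sum_apply, Pi.single_apply]
    have := congrArg (fun v : EuclideanSpace ℂ κ => v k) (hV j)
    rw [hx] at this
    simpa [mul_comm] using this.symm

/-- The Pick data `λ_j ↦ z_j` have a solution with a realization as soon as
`1 - conj(z_i) z_j` is a sum of positive matrices weighted by `1 - conj(λ_i) λ_j` and
`1 - δ² / (conj(λ_i) λ_j)`. -/
theorem exists_realization_of_gram {δ : ℝ} (hδ : 0 < δ) {ι α β : Type*} [Fintype ι]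
    [DecidableEq ι] [Fintype α] [Fintype β] [DecidableEq α] [DecidableEq β] {lam z : ι → ℂ}
    (hlam : ∀ j, lam j ∈ annulus δ) {x : α → ι → ℂ} {y : β → ι → ℂ}
    (h : ∀ i j, 1 - conj (z i) * z j =
      (1 - conj (lam i) * lam j) * ∑ k, conj (x k i) * x k j +
      (1 - conj (δ / lam i) * (δ / lam j)) * ∑ k, conj (y k i) * y k j) :
    ∃ (W : Matrix (Option (α ⊕ β)) (Option (α ⊕ β)) ℂ) (φ : ℂ → ℂ) (u : α ⊕ β → ℂ → ℂ),
      W.conjTranspose * W = 1 ∧ IsRealization δ W φ u ∧ IsRationalOn (annulus δ) φ ∧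
        ∀ j, φ (lam j) = z j := by
  let v : ι → α ⊕ β → ℂ := fun j => Sum.elim (fun k => x k j) fun k => y k j
  obtain ⟨W, hW, hv⟩ := exists_unitary_mulVec_eq
    (fun j (o : Option (α ⊕ β)) => o.elim 1 fun k => pencilEntry δ (lam j) k * v j k)
    (fun j (o : Option (α ⊕ β)) => o.elim (z j) fun k => v j k) fun i j => by
      simp only [Fintype.sum_option, Option.elim, Fintype.sum_sum_type, v, pencilEntry,
        Sum.elim_inl, Sum.elim_inr, map_mul, map_one, mul_one]
      rw [sum_mul_mul_mul, sum_mul_mul_mul]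
      linear_combination h i j
  obtain ⟨φ, u, hu, hφ⟩ := exists_isRealization hδ hW
  exact ⟨W, φ, u, hW, hu, hφ, fun j => hu.unique hδ hW (hlam j) (hv j)⟩

/-! ### Separation from a cone of weighted Gram matrices -/

open scoped MatrixOrder ComplexOrder in
theorem exists_gram_eq {ι : Type*} [Fintype ι] [DecidableEq ι] {A : Matrix ι ι ℂ}
    (hA : A.PosSemidef) : ∃ X : ι → ι → ℂ, ∀ i j, A i j = ∑ k, conj (X k i) * X k j := by
  obtain ⟨X, hX⟩ := CStarAlgebra.nonneg_iff_eq_star_mul_self.mp hA.nonneg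
  refine ⟨X, fun i j => ?_⟩
  rw [hX]
  simp [Matrix.mul_apply]

open scoped ComplexOrder in
-- A sum of positive matrices is positive, so it factors again through |ι| vectors. Keeping this
-- number fixed makes the cone convex and eventually bounds the model dimension by 2n.
theorem exists_gram_add {ι : Type*} [Fintype ι] [DecidableEq ι] (x y : ι → ι → ℂ) {s t : ℝ}
    (hs : 0 ≤ s) (ht : 0 ≤ t) : ∃ w : ι → ι → ℂ, ∀ i j, ∑ k, conj (w k i) * w k j =
      s * ∑ k, conj (x k i) * x k j + t * ∑ k, conj (y k i) * y k j := by
  have h := ((Matrix.posSemidef_conjTranspose_mul_self (Matrix.of x)).smul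
    (a := (s : ℂ)) (by exact_mod_cast hs)).add
    ((Matrix.posSemidef_conjTranspose_mul_self (Matrix.of y)).smul
      (a := (t : ℂ)) (by exact_mod_cast ht))
  obtain ⟨w, hw⟩ := exists_gram_eq h
  refine ⟨w, fun i j => ?_⟩
  rw [← hw]
  simp [Matrix.mul_apply]

variable {ι : Type*} [Fintype ι]

/-- The cone of all matrices `(a_ij ⟨x_i, x_j⟩ + b_ij ⟨y_i, y_j⟩)`. -/
def gramCone (a b : ι → ι → ℂ) : Set (ι → ι → ℂ) :=
  {C | ∃ x y : ι → ι → ℂ, ∀ i j, C i j = a i j * ∑ k, conj (x k i) * x k j +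
    b i j * ∑ k, conj (y k i) * y k j}

theorem gramCone_comm {a b : ι → ι → ℂ} : gramCone a b = gramCone b a := by
  ext C
  constructor <;> exact fun ⟨x, y, h⟩ => ⟨y, x, fun i j => (h i j).trans (add_comm _ _)⟩

theorem convex_gramCone [DecidableEq ι] (a b : ι → ι → ℂ) : Convex ℝ (gramCone a b) := by
  rintro C ⟨x, y, h⟩ C' ⟨x', y', h'⟩ s t hs ht -
  obtain ⟨w, hw⟩ := exists_gram_add x x' hs ht
  obtain ⟨v, hv⟩ := exists_gram_add y y' hs ht
  refine ⟨w, v, fun i j => ?_⟩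
  rw [hw, hv]
  simp only [Pi.add_apply, Pi.smul_apply, Complex.real_smul, h, h']
  ring

theorem norm_le_of_gram_le {a : ι → ι → ℂ} (ha : ∀ i, 0 < (a i i).re) {x : ι → ι → ℂ} {B : ℝ}
    (hB : 0 ≤ B) (h : ∀ i, (a i i).re * ∑ k, ‖x k i‖ ^ 2 ≤ B) :
    ‖x‖ ≤ 1 + ∑ i, B / (a i i).re := by
  have h0 : ∀ i, 0 ≤ B / (a i i).re := fun i => div_nonneg hB (ha i).le
  have hs : 0 ≤ ∑ i, B / (a i i).re := Finset.sum_nonneg fun i _ => h0 i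
  refine (pi_norm_le_iff_of_nonneg (by positivity)).mpr fun k =>
    (pi_norm_le_iff_of_nonneg (by positivity)).mpr fun i => ?_
  have h1 : ‖x k i‖ ^ 2 ≤ ∑ k, ‖x k i‖ ^ 2 :=
    Finset.single_le_sum (f := fun k => ‖x k i‖ ^ 2) (fun _ _ => by positivity)
      (Finset.mem_univ k)
  have h2 : ∑ k, ‖x k i‖ ^ 2 ≤ B / (a i i).re := by
    rw [le_div_iff₀ (ha i)]
    linarith [h i]
  have h3 : B / (a i i).re ≤ ∑ i, B / (a i i).re :=
    Finset.single_le_sum (f := fun i => B / (a i i).re) (fun i _ => h0 i) (Finset.mem_univ i)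
  -- Uses t ≤ 1 + t² to avoid a square root.
  nlinarith [sq_nonneg (‖x k i‖ - 1)]

/-- Positive diagonal weights let the diagonal of C bound the vectors x and y, so a convergent
sequence in the cone has convergent factors along a subsequence. -/
theorem isClosed_gramCone {a b : ι → ι → ℂ} (ha : ∀ i, 0 < (a i i).re)
    (hb : ∀ i, 0 < (b i i).re) : IsClosed (gramCone a b) := by
  refine IsSeqClosed.isClosed fun C C' hC hlim => ?_
  choose x y h using hC
  obtain ⟨B, hB⟩ := (Metric.isBounded_range_of_tendsto C hlim).exists_norm_le
  have hB' : ∀ m, ‖C m‖ ≤ B := fun m => hB _ ⟨m, rfl⟩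
  have hB0 : 0 ≤ B := (norm_nonneg _).trans (hB' 0)
  have hsum : ∀ m i, (a i i).re * ∑ k, ‖x m k i‖ ^ 2 + (b i i).re * ∑ k, ‖y m k i‖ ^ 2 ≤ B :=
    fun m i => by
      have h1 : (C m i i).re = (a i i).re * ∑ k, ‖x m k i‖ ^ 2 +
          (b i i).re * ∑ k, ‖y m k i‖ ^ 2 := by
        have e : ∀ w : ι → ι → ℂ, ∑ k, conj (w k i) * w k i = ((∑ k, ‖w k i‖ ^ 2 : ℝ) : ℂ) :=
          fun w => by
            push_cast
            exact Finset.sum_congr rfl fun k _ => by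
              rw [mul_comm, Complex.mul_conj, Complex.normSq_eq_norm_sq]
              norm_cast
        rw [h, e, e, Complex.add_re, Complex.re_mul_ofReal, Complex.re_mul_ofReal]
      rw [← h1]
      exact (Complex.re_le_norm _).trans
        (((norm_le_pi_norm _ i).trans (norm_le_pi_norm _ i)).trans (hB' m))
  have hn : ∀ (w : ι → ι → ℂ) i, 0 ≤ ∑ k, ‖w k i‖ ^ 2 := fun w i =>
    Finset.sum_nonneg fun _ _ => by positivity
  have hx : ∀ m, x m ∈ Metric.closedBall (0 : ι → ι → ℂ) (1 + ∑ i, B / (a i i).re) := fun m => by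
    rw [mem_closedBall_zero_iff]
    exact norm_le_of_gram_le ha hB0 fun i => by
      linarith [hsum m i, mul_nonneg (hb i).le (hn (y m) i)]
  have hy : ∀ m, y m ∈ Metric.closedBall (0 : ι → ι → ℂ) (1 + ∑ i, B / (b i i).re) := fun m => by
    rw [mem_closedBall_zero_iff]
    exact norm_le_of_gram_le hb hB0 fun i => by
      linarith [hsum m i, mul_nonneg (ha i).le (hn (x m) i)]
  obtain ⟨⟨x', y'⟩, -, s, hs, hlim'⟩ := ((isCompact_closedBall (0 : ι → ι → ℂ) _).prod
    (isCompact_closedBall (0 : ι → ι → ℂ) _)).tendsto_subseq (x := fun m => (x m, y m))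
    fun m => ⟨hx m, hy m⟩
  refine ⟨x', y', fun i j => ?_⟩
  have hcont : Continuous fun p : (ι → ι → ℂ) × (ι → ι → ℂ) =>
      a i j * ∑ k, conj (p.1 k i) * p.1 k j + b i j * ∑ k, conj (p.2 k i) * p.2 k j := by
    fun_prop
  have h1 := (hcont.tendsto _).comp hlim'
  have h2 : Filter.Tendsto (fun m => C (s m) i j) Filter.atTop (nhds (C' i j)) :=
    ((tendsto_pi_nhds.mp (tendsto_pi_nhds.mp hlim i) j)).comp hs.tendsto_atTop
  refine tendsto_nhds_unique h2 (h1.congr fun m => ?_)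
  exact (h (s m) i j).symm

theorem smul_mem_gramCone {a b C : ι → ι → ℂ} (hC : C ∈ gramCone a b) (t : ℝ) :
    (fun i j => (t : ℂ) ^ 2 * C i j) ∈ gramCone a b := by
  obtain ⟨x, y, h⟩ := hC
  refine ⟨fun i j => t * x i j, fun i j => t * y i j, fun i j => ?_⟩
  simp only [map_mul, Complex.conj_ofReal, sum_mul_mul_mul, h]
  ring

theorem rankOne_mem_gramCone [DecidableEq ι] (a b : ι → ι → ℂ) (c : ι → ℂ) :
    (fun i j => a i j * (conj (c i) * c j)) ∈ gramCone a b := by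
  rcases isEmpty_or_nonempty ι with hι | ⟨⟨k₀⟩⟩
  · exact ⟨0, 0, fun i => isEmptyElim i⟩
  · refine ⟨fun k i => if k = k₀ then c i else 0, 0, fun i j => ?_⟩
    simp [Finset.sum_ite_eq']

/-- A Hermitian matrix outside the cone is separated from it by a Hermitian matrix. -/
theorem exists_separating_of_notMem_gramCone [DecidableEq ι] {a b C : ι → ι → ℂ}
    (ha : ∀ i, 0 < (a i i).re) (hb : ∀ i, 0 < (b i i).re) (ha' : ∀ i j, conj (a i j) = a j i)
    (hb' : ∀ i j, conj (b i j) = b j i) (hC' : ∀ i j, conj (C i j) = C j i)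
    (hC : C ∉ gramCone a b) :
    ∃ K : Matrix ι ι ℂ, K.IsHermitian ∧
      (∀ c : ι → ℂ, 0 ≤ (∑ i, ∑ j, K i j * (a i j * (conj (c i) * c j))).re) ∧
      (∀ c : ι → ℂ, 0 ≤ (∑ i, ∑ j, K i j * (b i j * (conj (c i) * c j))).re) ∧
      (∑ i, ∑ j, K i j * C i j).re < 0 := by
  obtain ⟨f, s, hf, hs⟩ := RCLike.geometric_hahn_banach_closed_point (𝕜 := ℂ)
    (convex_gramCone a b) (isClosed_gramCone ha hb) hC
  have hs0 : 0 < s := by simpa using hf 0 ⟨0, 0, by simp⟩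
  have hcone : ∀ P ∈ gramCone a b, (f P).re ≤ 0 := fun P hP => by
    by_contra! hpos
    -- Were Re f(P) positive, the multiple of P by s / Re f(P) would stay in the cone while Re f
    -- reaches the bound s.
    have h1 := hf _ (smul_mem_gramCone hP (Real.sqrt (s / (f P).re)))
    have h2 : (fun i j => ((Real.sqrt (s / (f P).re) : ℝ) : ℂ) ^ 2 * P i j) =
        ((s / (f P).re : ℝ) : ℂ) • P := by
      ext i j
      rw [← Complex.ofReal_pow, Real.sq_sqrt (by positivity)]
      rfl
    rw [h2, map_smul, smul_eq_mul, RCLike.re_eq_complex_re, Complex.re_ofReal_mul,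
      div_mul_cancel₀ _ hpos.ne'] at h1
    exact lt_irrefl _ h1
  let L : ι → ι → ℂ := fun i j => -f (Pi.single i (Pi.single j 1))
  have hL : ∀ P : ι → ι → ℂ, f P = -∑ i, ∑ j, L i j * P i j := fun P => by
    have : P = ∑ i, ∑ j, P i j • Pi.single i (Pi.single j (1 : ℂ)) := by
      ext i j
      simp [Finset.sum_apply, Pi.single_apply, ite_apply]
    conv_lhs => rw [this]
    simp only [map_sum, map_smul, L, smul_eq_mul, neg_mul, Finset.sum_neg_distrib, neg_neg]
    exact Finset.sum_congr rfl fun i _ => Finset.sum_congr rfl fun j _ => mul_comm _ _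
  -- The Hermitian part of L has the same pairing, up to real parts, with every Hermitian matrix.
  let K : Matrix ι ι ℂ := Matrix.of fun i j => (L i j + conj (L j i)) / 2
  have hK : ∀ P : ι → ι → ℂ, (∀ i j, conj (P i j) = P j i) →
      (∑ i, ∑ j, K i j * P i j).re = -(f P).re := fun P hP => by
    have h1 : ∑ i, ∑ j, conj (L j i) * P i j = conj (∑ i, ∑ j, L i j * P i j) := by
      rw [Finset.sum_comm]
      simp only [map_sum, map_mul, hP]
    have h2 : ∑ i, ∑ j, K i j * P i j =
        (∑ i, ∑ j, L i j * P i j + ∑ i, ∑ j, conj (L j i) * P i j) / 2 := by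
      simp only [← Finset.sum_add_distrib, Finset.sum_div, K, Matrix.of_apply]
      exact Finset.sum_congr rfl fun i _ => Finset.sum_congr rfl fun j _ => by ring
    rw [h2, h1, hL, Complex.add_conj, Complex.neg_re, neg_neg, Complex.div_ofNat_re,
      Complex.ofReal_re, mul_div_cancel_left₀ _ two_ne_zero]
  refine ⟨K, ?_, fun c => ?_, fun c => ?_, ?_⟩
  · ext i j
    simp [K, add_comm]
  · rw [hK _ fun i j => by simp [ha', mul_comm]]
    linarith [hcone _ (rankOne_mem_gramCone a b c)]
  · rw [hK _ fun i j => by simp [hb', mul_comm]]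
    linarith [hcone _ (gramCone_comm (a := b) (b := a) ▸ rankOne_mem_gramCone b a c)]
  · rw [hK _ hC']
    have : s < (f C).re := hs
    linarith

/-! ### The compact family of test operators -/

theorem aeval_apply_of_apply_eq_smul {H : Type*} [NormedAddCommGroup H] [NormedSpace ℂ H]
    {T : H →L[ℂ] H} {x : H} {l : ℂ} (h : T x = l • x) (p : Polynomial ℂ) :
    Polynomial.aeval T p x = p.eval l • x := by
  induction p using Polynomial.induction_on' with
  | add p q hp hq => simp [hp, hq, add_smul]
  | monomial k a =>
    have hk : (T ^ k) x = l ^ k • x := by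
      induction k with
      | zero => simp
      | succ k ih => rw [pow_succ', mul_apply_eq_comp, ih, map_smul, h, smul_smul, pow_succ]
    rw [Polynomial.aeval_monomial, Polynomial.eval_monomial, mul_apply_eq_comp, hk]
    simp [Algebra.algebraMap_eq_smul_one, mul_smul, smul_comm a]

theorem mem_spectrum_iff_det_eq_zero {H : Type*} [NormedAddCommGroup H] [NormedSpace ℂ H]
    [FiniteDimensional ℂ H] (T : H →L[ℂ] H) (w : ℂ) :
    w ∈ spectrum ℂ T ↔ (w • 1 - T).det = 0 := by
  have := FiniteDimensional.complete ℂ H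
  rw [spectrum.mem_iff, ContinuousLinearMap.isUnit_iff_bijective, ← not_iff_not, not_not,
    Algebra.algebraMap_eq_smul_one, ContinuousLinearMap.det, ← ne_eq, ← isUnit_iff_ne_zero,
    ← LinearMap.isUnit_iff_isUnit_det, Module.End.isUnit_iff]
  rfl

variable {ι : Type*} [Fintype ι] {δ : ℝ} {lam : ι → ℂ}

/-- The Douglas-Paulsen operators on `ℂ^ι` with characteristic polynomial `∏ (X - λ_j)`. -/
def testOperators (δ : ℝ) (lam : ι → ℂ) :
    Set (EuclideanSpace ℂ ι →L[ℂ] EuclideanSpace ℂ ι) :=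
  {T | ‖T‖ ≤ 1 ∧ (∀ x, δ * ‖x‖ ≤ ‖T x‖) ∧ ∀ w : ℂ, (w • 1 - T).det = ∏ j, (w - lam j)}

/-- The family is cut out by closed conditions: the lower bound replaces ‖T⁻¹‖ ≤ 1/δ, and the
determinant identity fixes the spectrum with multiplicity, so nothing is lost in a limit. -/
theorem isCompact_testOperators : IsCompact (testOperators δ lam) := by
  have : ProperSpace (EuclideanSpace ℂ ι →L[ℂ] EuclideanSpace ℂ ι) :=
    FiniteDimensional.proper ℂ _
  refine Metric.isCompact_of_isClosed_isBounded ?_ ?_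
  · have : testOperators δ lam = {T | ‖T‖ ≤ 1} ∩ ((⋂ x, {T | δ * ‖x‖ ≤ ‖T x‖}) ∩
        ⋂ w : ℂ, {T | (w • 1 - T).det = ∏ j, (w - lam j)}) := by
      ext T
      simp [testOperators]
    rw [this]
    refine (isClosed_le continuous_norm continuous_const).inter (IsClosed.inter ?_ ?_)
    · exact isClosed_iInter fun x => isClosed_le continuous_const (by fun_prop)
    · exact isClosed_iInter fun w => isClosed_eq
        (ContinuousLinearMap.continuous_det.comp (continuous_const.sub continuous_id))
        continuous_const
  · exact (Metric.isBounded_closedBall (x := 0) (r := 1)).subset fun T hT =>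
      mem_closedBall_zero_iff.mpr hT.1

theorem spectrum_eq_of_mem_testOperators {T : EuclideanSpace ℂ ι →L[ℂ] EuclideanSpace ℂ ι}
    (hT : T ∈ testOperators δ lam) : spectrum ℂ T = Set.range lam := by
  ext w
  rw [mem_spectrum_iff_det_eq_zero, hT.2.2, Finset.prod_eq_zero_iff]
  simp only [Finset.mem_univ, true_and, Set.mem_range, sub_eq_zero, eq_comm]

theorem dpFamily_of_mem_testOperators (hδ : 0 < δ) (hlam : ∀ j, lam j ∈ annulus δ)
    {T : EuclideanSpace ℂ ι →L[ℂ] EuclideanSpace ℂ ι} (hT : T ∈ testOperators δ lam) :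
    DPFamily δ T := by
  have hs : spectrum ℂ T ⊆ annulus δ := by
    rw [spectrum_eq_of_mem_testOperators hT]
    rintro _ ⟨j, rfl⟩
    exact hlam j
  have hu := isUnit_of_spectrum_subset hδ hs
  refine ⟨⟨hT.1, hu, ContinuousLinearMap.opNorm_le_bound _ (by positivity) fun x => ?_⟩, hs⟩
  have h1 := hT.2.1 (Ring.inverse T x)
  rw [← mul_apply_eq_comp, Ring.mul_inverse_cancel _ hu, one_apply_eq_self] at h1
  rw [one_div, inv_mul_eq_div, le_div_iff₀ hδ]
  linarith

theorem exists_eigenvectors_of_mem_testOperators (hinj : Function.Injective lam)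
    {T : EuclideanSpace ℂ ι →L[ℂ] EuclideanSpace ℂ ι} (hT : T ∈ testOperators δ lam) :
    ∃ k : ι → EuclideanSpace ℂ ι, (∀ j, T (k j) = lam j • k j) ∧
      ∀ A B : EuclideanSpace ℂ ι →L[ℂ] EuclideanSpace ℂ ι, (∀ j, A (k j) = B (k j)) → A = B := by
  have hev : ∀ j, Module.End.HasEigenvalue (T : EuclideanSpace ℂ ι →ₗ[ℂ] EuclideanSpace ℂ ι)
      (lam j) := fun j => by
    rw [Module.End.hasEigenvalue_iff_mem_spectrum, spectrum.mem_iff,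
      LinearMap.isUnit_iff_isUnit_det, isUnit_iff_ne_zero, not_not]
    have : (lam j • 1 - T).det = 0 := by
      rw [hT.2.2]
      exact Finset.prod_eq_zero (Finset.mem_univ j) (sub_self _)
    exact this
  choose k hk using fun j => (hev j).exists_hasEigenvector
  have hli : LinearIndependent ℂ k := Module.End.eigenvectors_linearIndependent' _ lam hinj k hk
  let b := basisOfLinearIndependentOfCardEqFinrank' k hli (by simp)
  refine ⟨k, fun j => (hk j).apply_eq_smul, fun A B h => ?_⟩
  have : (A : EuclideanSpace ℂ ι →ₗ[ℂ] EuclideanSpace ℂ ι) = B :=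
    b.ext fun j => by simpa [b] using h j
  exact ContinuousLinearMap.coe_injective this

/-- Distinct eigenvalues give an eigenbasis, on which both operators act by φ(λ_j). Hence all
interpolants agree at a test operator. -/
theorem scalarCalc_eq_aeval (hδ0 : 0 < δ) (hδ : δ < 1) (hlam : ∀ j, lam j ∈ annulus δ)
    (hinj : Function.Injective lam) {T : EuclideanSpace ℂ ι →L[ℂ] EuclideanSpace ℂ ι}
    (hT : T ∈ testOperators δ lam) {φ : ℂ → ℂ} (hφ : DifferentiableOn ℂ φ (annulus δ))
    {p : Polynomial ℂ} (hp : ∀ j, p.eval (lam j) = φ (lam j)) :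
    scalarCalc δ φ T = Polynomial.aeval T p := by
  obtain ⟨k, hk, hext⟩ := exists_eigenvectors_of_mem_testOperators hinj hT
  refine hext _ _ fun j => ?_
  rw [scalarCalc_apply_eigenvector hδ0 hδ (dpFamily_of_mem_testOperators hδ0 hlam hT).2 hφ
    (hlam j) (hk j), aeval_apply_of_apply_eq_smul (hk j), hp]

/-! ### Test operators from a prescribed eigenbasis -/

section Conjugation

variable [DecidableEq ι]

theorem det_toEuclideanCLM (A : Matrix ι ι ℂ) :
    (Matrix.toEuclideanCLM (n := ι) (𝕜 := ℂ) A).det = A.det := by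
  rw [ContinuousLinearMap.det, Matrix.coe_toEuclideanCLM_eq_toEuclideanLin]
  simp

/-- The operator with eigenvalues `λ_j` and eigenvectors the columns of `S`. -/
noncomputable def conjDiagonal (lam : ι → ℂ) (S : Matrix ι ι ℂ) :
    EuclideanSpace ℂ ι →L[ℂ] EuclideanSpace ℂ ι :=
  Matrix.toEuclideanCLM (n := ι) (𝕜 := ℂ) (S * Matrix.diagonal lam * S⁻¹)

variable {S : Matrix ι ι ℂ}

theorem conjDiagonal_apply (hS : IsUnit S.det) (c : ι → ℂ) :
    conjDiagonal lam S (WithLp.toLp 2 (S.mulVec c)) =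
      WithLp.toLp 2 (S.mulVec fun j => lam j * c j) := by
  rw [conjDiagonal, Matrix.toEuclideanCLM_toLp, Matrix.mulVec_mulVec, mul_assoc,
    Matrix.nonsing_inv_mul _ hS, mul_one, ← Matrix.mulVec_mulVec]
  congr 2
  ext j
  simp [Matrix.mulVec_diagonal]

theorem aeval_conjDiagonal_apply (hS : IsUnit S.det) (p : Polynomial ℂ) (c : ι → ℂ) :
    Polynomial.aeval (conjDiagonal lam S) p (WithLp.toLp 2 (S.mulVec c)) =
      WithLp.toLp 2 (S.mulVec fun j => p.eval (lam j) * c j) := by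
  have h1 : ∀ c : ι → ℂ, (WithLp.toLp 2 (S.mulVec c) : EuclideanSpace ℂ ι) =
      ∑ j, c j • WithLp.toLp 2 (S.mulVec (Pi.single j 1)) := fun c => by
    ext i
    simp [Matrix.mulVec, dotProduct, Finset.sum_apply, mul_comm]
  rw [h1, h1, map_sum]
  refine Finset.sum_congr rfl fun j _ => ?_
  have h2 : conjDiagonal lam S (WithLp.toLp 2 (S.mulVec (Pi.single j 1))) =
      lam j • WithLp.toLp 2 (S.mulVec (Pi.single j 1)) := by
    rw [conjDiagonal_apply hS, ← WithLp.toLp_smul, ← Matrix.mulVec_smul]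
    congr 2
    ext i
    by_cases h : i = j <;> simp [h]
  rw [map_smul, aeval_apply_of_apply_eq_smul h2, smul_smul, mul_comm]

theorem conjDiagonal_mem_testOperators (hδ : 0 < δ) (hlam : ∀ j, lam j ∈ annulus δ)
    (hS : IsUnit S.det)
    (h1 : ∀ c : ι → ℂ, ‖(WithLp.toLp 2 (S.mulVec fun j => lam j * c j) : EuclideanSpace ℂ ι)‖ ≤
      ‖(WithLp.toLp 2 (S.mulVec c) : EuclideanSpace ℂ ι)‖)
    (h2 : ∀ c : ι → ℂ, ‖(WithLp.toLp 2 (S.mulVec fun j => δ / lam j * c j) : EuclideanSpace ℂ ι)‖ ≤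
      ‖(WithLp.toLp 2 (S.mulVec c) : EuclideanSpace ℂ ι)‖) :
    conjDiagonal lam S ∈ testOperators δ lam := by
  have hsurj : ∀ x : EuclideanSpace ℂ ι, ∃ c : ι → ℂ, x = WithLp.toLp 2 (S.mulVec c) := fun x =>
    ⟨S⁻¹.mulVec x.ofLp, by rw [Matrix.mulVec_mulVec, Matrix.mul_nonsing_inv _ hS,
      Matrix.one_mulVec]⟩
  refine ⟨ContinuousLinearMap.opNorm_le_bound _ zero_le_one fun x => ?_, fun x => ?_, fun w => ?_⟩
  · obtain ⟨c, rfl⟩ := hsurj x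
    rw [conjDiagonal_apply hS, one_mul]
    exact h1 c
  · obtain ⟨c, rfl⟩ := hsurj x
    rw [conjDiagonal_apply hS]
    -- Contractivity of δ/λ_j on vectors already multiplied by λ_j is the lower bound δ‖x‖ ≤ ‖Tx‖.
    have h3 := h2 fun j => lam j * c j
    have h4 : (fun j => δ / lam j * (lam j * c j)) = (δ : ℂ) • c := by
      ext j
      have := ne_zero_of_mem_annulus hδ.le (hlam j)
      simp only [Pi.smul_apply, smul_eq_mul]
      field_simp
    rw [h4, Matrix.mulVec_smul, WithLp.toLp_smul, norm_smul, Complex.norm_real,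
      Real.norm_eq_abs, abs_of_pos hδ] at h3
    exact h3
  · have h3 : w • 1 - conjDiagonal lam S = Matrix.toEuclideanCLM (n := ι) (𝕜 := ℂ)
        (S * Matrix.diagonal (fun j => w - lam j) * S⁻¹) := by
      rw [conjDiagonal, ← map_one (Matrix.toEuclideanCLM (n := ι) (𝕜 := ℂ)), ← map_smul,
        ← map_sub]
      congr 1
      have : Matrix.diagonal (fun j => w - lam j) = w • (1 : Matrix ι ι ℂ) - Matrix.diagonal lam := by
        rw [Matrix.smul_one_eq_diagonal, Matrix.diagonal_sub]
      rw [this, mul_sub, sub_mul, mul_smul_comm, mul_one, smul_mul_assoc,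
        Matrix.mul_nonsing_inv _ hS]
    rw [h3, det_toEuclideanCLM, Matrix.det_mul, Matrix.det_mul, Matrix.det_diagonal, mul_right_comm,
      ← Matrix.det_mul, Matrix.mul_nonsing_inv _ hS, Matrix.det_one, one_mul]

theorem testOperators_nonempty (hδ : 0 < δ) (hlam : ∀ j, lam j ∈ annulus δ) :
    (testOperators δ lam).Nonempty := by
  have key : ∀ a : ι → ℂ, (∀ j, ‖a j‖ ≤ 1) → ∀ c : ι → ℂ,
      ‖(WithLp.toLp 2 ((1 : Matrix ι ι ℂ).mulVec fun j => a j * c j) : EuclideanSpace ℂ ι)‖ ≤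
        ‖(WithLp.toLp 2 ((1 : Matrix ι ι ℂ).mulVec c) : EuclideanSpace ℂ ι)‖ := fun a ha c => by
    rw [Matrix.one_mulVec, Matrix.one_mulVec, EuclideanSpace.norm_eq, EuclideanSpace.norm_eq]
    refine Real.sqrt_le_sqrt (Finset.sum_le_sum fun j _ => ?_)
    simp only [norm_mul]
    exact pow_le_pow_left₀ (by positivity) (mul_le_of_le_one_left (norm_nonneg _) (ha j)) 2
  exact ⟨_, conjDiagonal_mem_testOperators (S := 1) hδ hlam (by simp)
    (key _ fun j => (hlam j).2.le)
    (key _ fun j => (norm_pencilEntry_lt hδ (hlam j) (Sum.inr () : Unit ⊕ Unit)).le)⟩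

open scoped MatrixOrder ComplexOrder in
/-- `‖S c‖²` realizes a positive form plus `ε` times the standard one. -/
theorem exists_isUnit_det_norm_mulVec_sq {K : Matrix ι ι ℂ} (hK : K.IsHermitian)
    (hK0 : ∀ c : ι → ℂ, 0 ≤ (∑ i, ∑ j, K i j * (conj (c i) * c j)).re) {ε : ℝ} (hε : 0 < ε) :
    ∃ S : Matrix ι ι ℂ, IsUnit S.det ∧ ∀ c : ι → ℂ,
      ‖(WithLp.toLp 2 (S.mulVec c) : EuclideanSpace ℂ ι)‖ ^ 2 =
        (∑ i, ∑ j, K i j * (conj (c i) * c j)).re + ε * ∑ i, ‖c i‖ ^ 2 := by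
  have hq : ∀ c : ι → ℂ, star c ⬝ᵥ K.mulVec c = ∑ i, ∑ j, K i j * (conj (c i) * c j) := fun c => by
    simp only [dotProduct, Matrix.mulVec, Finset.mul_sum]
    exact Finset.sum_congr rfl fun i _ => Finset.sum_congr rfl fun j _ => by
      simp only [Pi.star_apply, RCLike.star_def]
      ring
  have hpsd : K.PosSemidef := Matrix.PosSemidef.of_dotProduct_mulVec_nonneg hK fun c => by
    have him : (star c ⬝ᵥ K.mulVec c).im = 0 := hK.im_star_dotProduct_mulVec_self c
    rw [Complex.le_def]
    exact ⟨by rw [hq]; exact hK0 c, him.symm⟩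
  have hpd : (K + (ε : ℂ) • (1 : Matrix ι ι ℂ)).PosDef :=
    Matrix.PosDef.posSemidef_add hpsd (Matrix.PosDef.one.smul (by exact_mod_cast hε))
  obtain ⟨S, hS, hKS⟩ := CStarAlgebra.isStrictlyPositive_iff_eq_star_mul_self.mp
    hpd.isStrictlyPositive
  refine ⟨S, (Matrix.isUnit_iff_isUnit_det _).mp hS, fun c => ?_⟩
  have h1 : star c ⬝ᵥ (K + (ε : ℂ) • (1 : Matrix ι ι ℂ)).mulVec c =
      star (S.mulVec c) ⬝ᵥ S.mulVec c := by
    rw [hKS, ← Matrix.mulVec_mulVec, Matrix.star_mulVec, Matrix.dotProduct_mulVec]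
    rfl
  have h2 : ∀ v : ι → ℂ, star v ⬝ᵥ v = ((∑ i, ‖v i‖ ^ 2 : ℝ) : ℂ) := fun v => by
    simp only [dotProduct, Pi.star_apply, RCLike.star_def, Complex.conj_mul']
    push_cast
    rfl
  rw [Matrix.add_mulVec, dotProduct_add, hq, Matrix.smul_mulVec, Matrix.one_mulVec,
    dotProduct_smul, h2, h2] at h1
  have h3 := congrArg Complex.re h1
  rw [Complex.add_re, smul_eq_mul, Complex.re_ofReal_mul, Complex.ofReal_re,
    Complex.ofReal_re] at h3
  rw [EuclideanSpace.norm_sq_eq, h3]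

end Conjugation

/-! ### The Pick problem -/

section Pick

variable {ι : Type*} [Fintype ι] {δ : ℝ} {lam z : ι → ℂ}

theorem sum_mul_one_sub_mul (K : Matrix ι ι ℂ) (w c : ι → ℂ) :
    ∑ i, ∑ j, K i j * ((1 - conj (w i) * w j) * (conj (c i) * c j)) =
      ∑ i, ∑ j, K i j * (conj (c i) * c j) -
        ∑ i, ∑ j, K i j * (conj (w i * c i) * (w j * c j)) := by
  simp only [← Finset.sum_sub_distrib, map_mul]
  exact Finset.sum_congr rfl fun i _ => Finset.sum_congr rfl fun j _ => by ring

/-- A separating Hermitian matrix K would be, up to perturbation, the Gram matrix of the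
eigenvectors of a test operator on which p is not contractive. -/
theorem one_sub_mem_gramCone [DecidableEq ι] (hδ : 0 < δ) (hlam : ∀ j, lam j ∈ annulus δ)
    {p : Polynomial ℂ} (hp : ∀ j, p.eval (lam j) = z j)
    (h : ∀ T ∈ testOperators δ lam, ‖Polynomial.aeval T p‖ ≤ 1) :
    (fun i j => 1 - conj (z i) * z j) ∈ gramCone (fun i j => 1 - conj (lam i) * lam j)
      fun i j => 1 - conj (δ / lam i) * (δ / lam j) := by
  have hlam' : ∀ j, ‖lam j‖ < 1 := fun j => (hlam j).2
  have hlam'' : ∀ j, ‖(δ : ℂ) / lam j‖ < 1 := fun j =>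
    norm_pencilEntry_lt hδ (hlam j) (Sum.inr () : Unit ⊕ Unit)
  have hpos : ∀ w : ℂ, ‖w‖ < 1 → 0 < (1 - conj w * w).re := fun w hw => by
    rw [Complex.conj_mul', ← Complex.ofReal_pow, Complex.sub_re, Complex.one_re,
      Complex.ofReal_re, sub_pos]
    exact pow_lt_one₀ (norm_nonneg _) hw two_ne_zero
  have hherm : ∀ v w : ℂ, conj (1 - conj v * w) = 1 - conj w * v := fun v w => by
    simp [mul_comm]
  by_contra hC
  obtain ⟨K, hK, hKa, hKb, hKC⟩ := exists_separating_of_notMem_gramCone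
    (fun i => hpos _ (hlam' i)) (fun i => hpos _ (hlam'' i)) (fun i j => hherm _ _)
    (fun i j => hherm _ _) (fun i j => hherm _ _) hC
  let Q : (ι → ℂ) → ℝ := fun c => (∑ i, ∑ j, K i j * (conj (c i) * c j)).re
  have hQa : ∀ c : ι → ℂ, Q (fun j => lam j * c j) ≤ Q c := fun c => by
    have := hKa c
    rw [sum_mul_one_sub_mul, Complex.sub_re] at this
    exact sub_nonneg.mp this
  have hQb : ∀ c : ι → ℂ, Q (fun j => δ / lam j * c j) ≤ Q c := fun c => by
    have := hKb c
    rw [sum_mul_one_sub_mul, Complex.sub_re] at this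
    exact sub_nonneg.mp this
  -- Separation alone does not make K positive. But Q(λᵐc) ≤ Q(c) for all m, and λᵐc → 0 because
  -- |λ_j| < 1.
  have hQ0 : ∀ c, 0 ≤ Q c := fun c => by
    have hle : ∀ m : ℕ, Q (fun j => lam j ^ m * c j) ≤ Q c := fun m => by
      induction m with
      | zero => simp
      | succ m ih =>
        refine le_trans (le_of_eq ?_) ((hQa _).trans ih)
        simp only [pow_succ', mul_assoc]
    have hlim : Filter.Tendsto (fun m : ℕ => fun j => lam j ^ m * c j) Filter.atTop (nhds 0) :=
      tendsto_pi_nhds.mpr fun j => by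
        simpa using (tendsto_pow_atTop_nhds_zero_of_norm_lt_one (hlam' j)).mul_const (c j)
    have hcont : Continuous Q := by fun_prop
    have := le_of_tendsto ((hcont.tendsto 0).comp hlim) (Filter.Eventually.of_forall hle)
    simpa [Q] using this
  have hle : ∀ w : ι → ℂ, (∀ j, ‖w j‖ < 1) → ∀ c : ι → ℂ,
      ∑ j, ‖w j * c j‖ ^ 2 ≤ ∑ j, ‖c j‖ ^ 2 := fun w hw c =>
    Finset.sum_le_sum fun j _ => pow_le_pow_left₀ (norm_nonneg _) (by
      rw [norm_mul]
      exact mul_le_of_le_one_left (norm_nonneg _) (hw j).le) 2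
  have hz : Q z ≤ Q 1 := by
    -- Q may be degenerate. Adding ε times the standard form makes `S` invertible, and both
    -- multipliers remain contractive since |λ_j| and |δ/λ_j| are below 1.
    have key : ∀ ε > 0, Q z ≤ Q 1 + ε * ∑ j : ι, ‖(1 : ι → ℂ) j‖ ^ 2 := fun ε hε => by
      obtain ⟨S, hS, hSn⟩ := exists_isUnit_det_norm_mulVec_sq hK hQ0 hε
      have hmem : conjDiagonal lam S ∈ testOperators δ lam := by
        refine conjDiagonal_mem_testOperators hδ hlam hS (fun c => ?_) fun c => ?_
        · refine le_of_sq_le_sq ?_ (norm_nonneg _)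
          rw [hSn, hSn]
          exact add_le_add (hQa c) (mul_le_mul_of_nonneg_left (hle _ hlam' c) hε.le)
        · refine le_of_sq_le_sq ?_ (norm_nonneg _)
          rw [hSn, hSn]
          exact add_le_add (hQb c) (mul_le_mul_of_nonneg_left (hle _ hlam'' c) hε.le)
      -- The sum of the eigenvectors is the test vector: p(T) sends S·1 to S·z.
      have h1 := ContinuousLinearMap.le_of_opNorm_le _ (h _ hmem) (WithLp.toLp 2 (S.mulVec 1))
      rw [aeval_conjDiagonal_apply hS, one_mul] at h1
      have h2 := pow_le_pow_left₀ (norm_nonneg _) h1 2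
      rw [hSn, hSn] at h2
      simp only [hp, Pi.one_apply, mul_one] at h2
      have h3 : 0 ≤ ε * ∑ j, ‖z j‖ ^ 2 :=
        mul_nonneg hε.le (Finset.sum_nonneg fun _ _ => by positivity)
      simp only [Q, Pi.one_apply, mul_one]
      linarith
    have hlim : Filter.Tendsto (fun ε : ℝ => Q 1 + ε * ∑ j : ι, ‖(1 : ι → ℂ) j‖ ^ 2)
        (nhdsWithin 0 (Set.Ioi 0)) (nhds (Q 1)) := by
      have : Continuous fun ε : ℝ => Q 1 + ε * ∑ j : ι, ‖(1 : ι → ℂ) j‖ ^ 2 := by fun_prop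
      simpa using (this.tendsto 0).mono_left nhdsWithin_le_nhds
    exact ge_of_tendsto hlim (Filter.eventually_of_mem self_mem_nhdsWithin key)
  -- The pairing of K with the Pick matrix has real part Q(1) - Q(z), negative by separation.
  have h1 := sum_mul_one_sub_mul K z 1
  simp only [Pi.one_apply, map_one, mul_one] at h1
  rw [h1, Complex.sub_re] at hKC
  simp only [Q, Pi.one_apply, map_one, mul_one] at hz
  linarith

/-- If `p` is contractive on all test operators, then `λ_j ↦ p(λ_j)` is solved by a function with a
realization on `ℂ^ι ⊕ ℂ^ι`. -/
theorem exists_realization_of_norm_aeval_le [DecidableEq ι] (hδ : 0 < δ)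
    (hlam : ∀ j, lam j ∈ annulus δ) {p : Polynomial ℂ} (hp : ∀ j, p.eval (lam j) = z j)
    (h : ∀ T ∈ testOperators δ lam, ‖Polynomial.aeval T p‖ ≤ 1) :
    ∃ (W : Matrix (Option (ι ⊕ ι)) (Option (ι ⊕ ι)) ℂ) (φ : ℂ → ℂ) (u : ι ⊕ ι → ℂ → ℂ),
      W.conjTranspose * W = 1 ∧ IsRealization δ W φ u ∧ IsRationalOn (annulus δ) φ ∧
        ∀ j, φ (lam j) = z j := by
  obtain ⟨x, y, hxy⟩ := one_sub_mem_gramCone hδ hlam hp h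
  exact exists_realization_of_gram hδ hlam hxy

end Pick

/-! ### Extremality on the test operators -/

theorem norm_scalarCalc_le_of_dpNorm_le {δ : ℝ} {φ : ℂ → ℂ} {c : ℝ} (hc : 0 ≤ c)
    (h : dpNorm δ φ ≤ ENNReal.ofReal c) {H : Type} [NormedAddCommGroup H] [InnerProductSpace ℂ H]
    [CompleteSpace H] {X : H →L[ℂ] H} (hX : DPFamily δ X) : ‖scalarCalc δ φ X‖ ≤ c := by
  have h1 : ‖scalarCalc δ φ X‖ₑ ≤ dpNorm δ φ := le_sSup ⟨H, _, _, inferInstance, X, hX, rfl⟩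
  rw [← ofReal_norm] at h1
  exact (ENNReal.ofReal_le_ofReal_iff hc).mp (h1.trans h)

theorem dpNorm_const_mul_le {δ : ℝ} {φ : ℂ → ℂ} (h : dpNorm δ φ ≤ 1) {c : ℝ} (hc : 0 ≤ c) :
    dpNorm δ (fun z => c * φ z) ≤ ENNReal.ofReal c := by
  refine sSup_le ?_
  rintro _ ⟨H, _, _, _, X, hX, rfl⟩
  have h1 := norm_scalarCalc_le_of_dpNorm_le zero_le_one (by simpa using h) hX
  rw [scalarCalc_const_mul, ← ofReal_norm, norm_smul, Complex.norm_real, Real.norm_eq_abs,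
    abs_of_nonneg hc]
  exact ENNReal.ofReal_le_ofReal (mul_le_of_le_one_right hc h1)

/-- For an extremal problem the interpolating polynomial has norm one at some test operator. -/
theorem ExtremallySolvable.exists_norm_aeval_eq_one {δ : ℝ} (hδ0 : 0 < δ) (hδ1 : δ < 1) {n : ℕ}
    {lam z : Fin n → ℂ} (hlam : ∀ j, lam j ∈ annulus δ) (hinj : Function.Injective lam)
    (hext : ExtremallySolvable δ lam z) {p : Polynomial ℂ} (hp : ∀ j, p.eval (lam j) = z j) :
    ∃ T ∈ testOperators δ lam, ‖Polynomial.aeval T p‖ = 1 ∧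
      ∀ T' ∈ testOperators δ lam, ‖Polynomial.aeval T' p‖ ≤ 1 := by
  obtain ⟨⟨φ₀, hφ₀, hz₀⟩, hmin⟩ := hext
  have hle : ∀ T ∈ testOperators δ lam, ‖Polynomial.aeval T p‖ ≤ 1 := fun T hT => by
    rw [← scalarCalc_eq_aeval hδ0 hδ1 hlam hinj hT hφ₀.1 fun j => (hp j).trans (hz₀ j).symm]
    exact norm_scalarCalc_le_of_dpNorm_le zero_le_one (by simpa using hφ₀.2)
      (dpFamily_of_mem_testOperators hδ0 hlam hT)
  obtain ⟨T, hT, hmax⟩ := (isCompact_testOperators (δ := δ) (lam := lam)).exists_isMaxOn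
    (testOperators_nonempty hδ0 hlam) (Polynomial.continuous_aeval p).norm.continuousOn
  refine ⟨T, hT, (hle T hT).antisymm ?_, hle⟩
  by_contra! hlt
  obtain ⟨ρ, hρ, hρ1⟩ := exists_between hlt
  have hρ0 : 0 < ρ := (norm_nonneg _).trans_lt hρ
  -- p/ρ is still contractive on all test operators, so the data z_j/ρ are solvable; multiplying
  -- that solution by ρ contradicts extremality.
  obtain ⟨W, φ, u, hW, hu, -, hφ⟩ := exists_realization_of_norm_aeval_le
    (p := Polynomial.C ((ρ : ℂ)⁻¹) * p) (z := fun j => (ρ : ℂ)⁻¹ * z j) hδ0 hlam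
    (fun j => by simp [hp]) fun T' hT' => by
      rw [map_mul, Polynomial.aeval_C, Algebra.algebraMap_eq_smul_one, smul_mul_assoc, one_mul,
        norm_smul, norm_inv, Complex.norm_real, Real.norm_eq_abs, abs_of_pos hρ0,
        inv_mul_le_one₀ hρ0]
      exact (hmax hT').trans hρ.le
  have hS := hu.dpSchur hδ0 hδ1 hW
  refine hmin ⟨fun z => ρ * φ z, hS.1.const_mul _,
    (dpNorm_const_mul_le hS.2 hρ0.le).trans_lt ?_, fun j => ?_⟩
  · rw [← ENNReal.ofReal_one]
    exact (ENNReal.ofReal_lt_ofReal_iff one_pos).mpr hρ1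
  · have : (ρ : ℂ) ≠ 0 := by exact_mod_cast hρ0.ne'
    simp only [hφ]
    field_simp

end DP

/-! ### The theorem -/

theorem theorem6p3 (δ : ℝ) (hδ0 : 0 < δ) (hδ1 : δ < 1) (n : ℕ) (lam z : Fin n → ℂ)
    (hlam : ∀ j, lam j ∈ DP.annulus δ) (hinj : Function.Injective lam)
    (hext : DP.ExtremallySolvable δ lam z) :
    ∃ φ : ℂ → ℂ, DP.DPSchur δ φ ∧ DP.IsRationalOn (DP.annulus δ) φ ∧ (∀ j, φ (lam j) = z j) ∧
      ∃ (M₁ M₂ : Type) (_ : NormedAddCommGroup M₁) (_ : InnerProductSpace ℂ M₁)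
        (_ : CompleteSpace M₁) (_ : FiniteDimensional ℂ M₁)
        (_ : NormedAddCommGroup M₂) (_ : InnerProductSpace ℂ M₂)
        (_ : CompleteSpace M₂) (_ : FiniteDimensional ℂ M₂)
        (u : ℂ → WithLp 2 (M₁ × M₂)),
        Module.finrank ℂ (WithLp 2 (M₁ × M₂)) ≤ 2 * n ∧ DP.IsDPModel δ φ u ∧
        ∃ (H : Type) (_ : NormedAddCommGroup H) (_ : InnerProductSpace ℂ H)
          (_ : CompleteSpace H) (_ : FiniteDimensional ℂ H) (T : H →L[ℂ] H),
          DP.DPFamilyAt δ lam T ∧ DP.dpNorm δ φ = 1 ∧ ‖DP.scalarCalc δ φ T‖ = 1 ∧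
          1 - (DP.scalarCalc δ φ T)† ∘L DP.scalarCalc δ φ T =
            (DP.vectorCalc δ u T)† ∘L
              (1 - (DP.operatorCalc δ (DP.pencil M₁ M₂ δ) T)† ∘L
                DP.operatorCalc δ (DP.pencil M₁ M₂ δ) T) ∘L
              DP.vectorCalc δ u T := by
  obtain ⟨p, hp⟩ : ∃ p : Polynomial ℂ, ∀ j, p.eval (lam j) = z j :=
    ⟨Lagrange.interpolate Finset.univ lam z, fun j =>
      Lagrange.eval_interpolate_at_node z hinj.injOn (Finset.mem_univ j)⟩
  obtain ⟨T, hT, hT1, hle⟩ := hext.exists_norm_aeval_eq_one hδ0 hδ1 hlam hinj hp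
  -- This φ is in general not the given solution, but it has the same values at the nodes, so φ(T) =
  -- p(T) has norm 1 at the extremal T.
  obtain ⟨W, φ, u, hW, hu, hrat, hφ⟩ := DP.exists_realization_of_norm_aeval_le hδ0 hlam hp hle
  have hS := hu.dpSchur hδ0 hδ1 hW
  have hTF := DP.dpFamily_of_mem_testOperators hδ0 hlam hT
  have hφT : ‖DP.scalarCalc δ φ T‖ = 1 := by
    rw [DP.scalarCalc_eq_aeval hδ0 hδ1 hlam hinj hT hu.1 fun j => (hp j).trans (hφ j).symm, hT1]
  refine ⟨φ, hS, hrat, hφ, EuclideanSpace ℂ (Fin n), EuclideanSpace ℂ (Fin n), _, _, inferInstance,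
    inferInstance, _, _, inferInstance, inferInstance, fun z => DP.stateVec fun k => u k z, ?_,
    hu.isDPModel hW, EuclideanSpace ℂ (Fin n), _, _, inferInstance, inferInstance, T,
    ⟨hTF, inferInstance, by simp, DP.spectrum_eq_of_mem_testOperators hT⟩, hS.2.antisymm ?_, hφT,
    hu.one_sub_adjoint_comp hδ0 hδ1 hW hTF.2⟩
  · rw [(WithLp.linearEquiv 2 ℂ _).finrank_eq, Module.finrank_prod]
    simp [two_mul]
  · refine le_sSup ⟨EuclideanSpace ℂ (Fin n), _, _, inferInstance, T, hTF, ?_⟩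
    rw [← ofReal_norm, hφT, ENNReal.ofReal_one]
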